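/- **Theorem 5.5.** Let $\kappa\ge 0$ and let $\nu$ be a measure on $(0,\infty)$ with $\int_0^\infty (1\wedge z)\,\nu(dz)<\infty$, and assume that $\kappa>0$ or $\nu((0,\infty))=\infty$. Put $w(s)=\nu([s,\infty))$ for $s>0$, $$\partial^w_t f(t)=\frac{d}{dt}\int_0^t w(s)\,\bigl(f(t-s)-f(0)\bigr)\,ds ,\qquad \phi(\lambda)=\kappa\lambda+\int_0^\infty(1-e^{-\lambda z})\,\nu(dz).$$ On a probability space let $S=(S_t)_{t\ge0}$ be a subordinator with drift $\kappa$ and Lévy measure $\nu$, that is, a non-negative càdlàg process with $S_0=0$, stationary independent increments and $E[e^{-\lambda S_t}]=e^{-t\phi(\lambda)}$ for $\lambda>0$, $t\ge 0$. Let $L_t=\inf\{r\ge0: S_r>t\}$, and let $B$ be a standard one-dimensional Brownian motion independent of $S$. Let $\sigma>0$ and $K>0$, let $Y_t=Y_0\exp(\sigma B_t-\tfrac12\sigma^2t)$ be geometric Brownian motion, and write $E_x$ for the expectation when $Y_0=x$. Consider the time-fractional PDE $$(\kappa\partial_t+\partial^w_t)u(t,x)=\tfrac12\sigma^2x^2\,\partial_x^2u(t,x)\quad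 (x>0,\ t>0),\qquad u(0,x)=(x-K)^+\quad (x>0).\tag{1}$$ A function $u(t,x)$ is called a *solution* of (1) if there is $\lambda_0\ge0$ such that for every $\lambda>\lambda_0$ the Laplace transform $\bar u(\lambda,x)=\int_0^\infty e^{-\lambda t}u(t,x)\,dt$ exists as an absolutely convergent integral for all $x>0$, has at most linear growth in $x$, i.e. $|\bar u(\lambda,x)|\le C_\lambda(1+x)$ for all $x>0$, and $\bar u(\lambda,\cdot)$ is a weak solution on $(0,\infty)$ of the Laplace-transformed equation $$\tfrac12\sigma^2x^2\,\partial_x^2\bar u(\lambda,x)-\phi(\lambda)\,\bar u(\lambda,x)+\frac{\phi(\lambda)}{\lambda}(x-K)^+=0,\tag{2}$$ meaning that $\bar u(\lambda,\cdot)$ is locally integrable on $(0,\infty)$ and, for every $\eta\in C_c^\infty((0,\infty))$, $$\int_0^\infty\Bigl(\tfrac12\sigma^2\,\bar u(\lambda,x)\,(x^2\eta(x))''-\phi(\lambda)\,\bar u(\lambda,x)\,\eta(x)+\tfrac{\phi(\lambda)}{\lambda}(x-K)^+\eta(x)\Bigr)dx=0 .$$ Then (1) has a unique solution, and it is given by $$u(t,x)=E_x\bigl[(Y_{L_t}-K)^+\bigr].$$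 More precisely: for all $t\ge0$ and $x>0$ the random variable $(Y_{L_t}-K)^+$ is integrable when $Y_0=x$; $u$ is a solution of (1), is continuous on $[0,\infty)\times(0,\infty)$ and satisfies $u(0,x)=(x-K)^+$ for all $x>0$. If $v$ is any solution of (1), then for almost every $x>0$ one has $v(t,x)=u(t,x)$ for almost every $t>0$. If in addition $\bar v(\lambda,\cdot)$ is continuous on $(0,\infty)$ for all sufficiently large $\lambda$, then for every $x>0$ one has $v(t,x)=u(t,x)$ for almost every $t>0$; and if $v$ is continuous on $(0,\infty)\times(0,\infty)$, then $v(t,x)=u(t,x)$ for all $t>0$ and $x>0$. -/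

import Mathlib

open MeasureTheory ProbabilityTheory Set Filter Topology
open scoped NNReal ENNReal

noncomputable section

namespace TimeFractionalBS

/-- A Lévy measure of a subordinator: a measure on `(0, ∞)` with `∫ (1 ∧ z) ν(dz) < ∞`. -/
structure IsLevyMeasure (ν : Measure ℝ) : Prop where
  null_Iic : ν (Iic 0) = 0
  lintegral_lt_top : ∫⁻ z in Ioi (0 : ℝ), ENNReal.ofReal (min 1 z) ∂ν < ∞

/-- The Laplace exponent `φ(l) = κ l + ∫_{(0,∞)} (1 - e^{-l z}) ν(dz)`. -/
def laplaceExponent (κ : ℝ) (ν : Measure ℝ) (l : ℝ) : ℝ :=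
  κ * l + ∫ z in Ioi (0 : ℝ), (1 - Real.exp (-l * z)) ∂ν

/-- `S` is a subordinator with drift `κ` and Lévy measure `ν`: a non-negative càdlàg process
started at `0` with stationary independent increments and `E[e^{-l S_t}] = e^{-t φ(l)}`. -/
structure IsSubordinator {Ω : Type*} [MeasurableSpace Ω] (κ : ℝ) (ν : Measure ℝ)
    (S : ℝ≥0 → Ω → ℝ) (P : Measure Ω) : Prop where
  measurable : ∀ t, Measurable (S t)
  zero : ∀ᵐ ω ∂P, S 0 ω = 0
  nonneg : ∀ᵐ ω ∂P, ∀ t, 0 ≤ S t ω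
  cadlag : ∀ᵐ ω ∂P, ∀ t, ContinuousWithinAt (fun r => S r ω) (Ici t) t ∧
    ∃ y : ℝ, Tendsto (fun r => S r ω) (𝓝[<] t) (𝓝 y)
  indepIncrements : HasIndepIncrements S P
  stationaryIncrements : ∀ s t,
    IdentDistrib (fun ω => S (s + t) ω - S s ω) (S t) P P
  laplace : ∀ (t : ℝ≥0) (l : ℝ), 0 < l →
    ∫ ω, Real.exp (-l * S t ω) ∂P = Real.exp (-(t : ℝ) * laplaceExponent κ ν l)

/-- The inverse `L_t = inf {r ≥ 0 : S_r > t}`. -/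
def inverseSubordinator {Ω : Type*} (S : ℝ≥0 → Ω → ℝ) (t : ℝ) (ω : Ω) : ℝ≥0 :=
  sInf {r : ℝ≥0 | t < S r ω}

/-- Geometric Brownian motion `Y_s = x exp(σ B_s - σ² s / 2)` started at `x`. -/
def geometricBM {Ω : Type*} (σ : ℝ) (B : ℝ≥0 → Ω → ℝ) (x : ℝ) (s : ℝ≥0) (ω : Ω) : ℝ :=
  x * Real.exp (σ * B s ω - σ ^ 2 / 2 * (s : ℝ))

/-- The payoff `(x - K)⁺` of the call option. -/
def callPayoff (K x : ℝ) : ℝ := max (x - K) 0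

/-- The function `u(t, x) = E_x[(Y_{L_t} - K)⁺]`. -/
def callValue {Ω : Type*} [MeasurableSpace Ω] (P : Measure Ω) (S B : ℝ≥0 → Ω → ℝ)
    (σ K t x : ℝ) : ℝ :=
  ∫ ω, callPayoff K (geometricBM σ B x (inverseSubordinator S t ω) ω) ∂P

/-- The Laplace transform in time, `∫₀^∞ e^{-l t} u(t, x) dt`. -/
def timeLaplace (u : ℝ → ℝ → ℝ) (l x : ℝ) : ℝ :=
  ∫ t in Ioi (0 : ℝ), Real.exp (-l * t) * u t x

/-- `f` is a weak (distributional) solution on `(0, ∞)` of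
`(σ² / 2) x² f'' - c f + g = 0`. -/
structure IsWeakSolution (σ c : ℝ) (g f : ℝ → ℝ) : Prop where
  locallyIntegrable : LocallyIntegrableOn f (Ioi 0)
  weak_eq : ∀ η : ℝ → ℝ, ContDiff ℝ (⊤ : ℕ∞) η → HasCompactSupport η → tsupport η ⊆ Ioi 0 →
    ∫ x in Ioi (0 : ℝ),
      (σ ^ 2 / 2 * f x * iteratedDeriv 2 (fun y => y ^ 2 * η y) x
        - c * f x * η x + g x * η x) = 0

/-- `u` solves `(κ ∂_t + ∂^w_t) u = (σ² / 2) x² ∂_x² u` on `(0, ∞) × (0, ∞)`, with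
`u(0, x) = ψ(x)` and `w(s) = ν([s, ∞))`, in the sense of Laplace transforms: for all large `l`
the transform exists for every `x > 0`, grows at most linearly in `x`, and is a weak solution of
the transformed equation `(σ² / 2) x² f'' - φ(l) f + (φ(l) / l) ψ = 0` on `(0, ∞)`. -/
def IsLaplaceSolution (κ : ℝ) (ν : Measure ℝ) (σ : ℝ) (ψ : ℝ → ℝ) (u : ℝ → ℝ → ℝ) : Prop :=
  ∃ l₀ : ℝ, 0 ≤ l₀ ∧ ∀ l, l₀ < l →
    (∀ x, 0 < x → IntegrableOn (fun t => Real.exp (-l * t) * u t x) (Ioi 0)) ∧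
    (∃ C : ℝ, ∀ x, 0 < x → |timeLaplace u l x| ≤ C * (1 + x)) ∧
    IsWeakSolution σ (laplaceExponent κ ν l)
      (fun x => laplaceExponent κ ν l / l * ψ x) (timeLaplace u l)

end TimeFractionalBS

end

open MeasureTheory ProbabilityTheory Set Filter Topology
open scoped NNReal ENNReal

noncomputable section

namespace TimeFractionalBS

/-! ### Logarithmic change of variables in the weak formulation -/

/-! Existence rests on one probabilistic fact. Let `e` be exponential of rate `l`, independent of
`S` and `B`. Up to null events `L_e > r` means `S_r < e`, so `P(L_e > r) = E[exp(-l S_r)] = exp(-r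
φ(l))`: the time `L_e` is exponential of rate `c = φ(l)` (`IsSubordinator.map_ratPathInv`). Hence
`l` times the Laplace transform of `u` is the expected payoff of geometric Brownian motion at an
independent exponential time of rate `c`, that is, `c` times a resolvent applied to the payoff. In
the variable `w = log x` this is an average over translations by a law with characteristic function
`c / (c + (σ²/2)(ξ² + iξ))` (`charFun_bsExpLaw`). The denominator is the symbol of the adjoint
operator up to sign, so Fourier inversion against test functions gives the weak equation
(`isWeakSolution_integral`).

For uniqueness, the difference of two transforms solves the homogeneous equation weakly. In
logarithmic coordinates its mollifications solve `a (G'' - G') = c G` with `a = σ²/2`. The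
characteristic exponents lie strictly above `1` and strictly below `0`, so growth `O(1 + e^y)`
excludes both (`eq_zero_of_ode_of_growth`) and the transforms agree almost everywhere. A Laplace
transform is determined by its values at large integers, so only countably many null sets of `x`
arise, and equality of transforms passes to `u` and `v`.

The condition that `κ > 0` or `ν` is infinite makes `φ` unbounded, so `S` is strictly increasing and
`L` is continuous. With the Lipschitz dependence on `x`, which comes from the mean-one martingale
factor, this gives joint continuity of `u`. -/

lemma integral_Ioi_eq_integral_exp (F : ℝ → ℝ) :
    ∫ x in Ioi (0 : ℝ), F x = ∫ w, Real.exp w * F (Real.exp w) := by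
  have h := integral_image_eq_integral_abs_deriv_smul (s := univ) (f := Real.exp)
    (f' := Real.exp) MeasurableSet.univ
    (fun x _ => (Real.hasDerivAt_exp x).hasDerivWithinAt) Real.exp_injective.injOn F
  simpa [image_univ, Real.range_exp, abs_of_pos (Real.exp_pos _)] using h

lemma locallyIntegrable_comp_exp {f : ℝ → ℝ} (hf : LocallyIntegrableOn f (Ioi 0)) :
    LocallyIntegrable (fun w => f (Real.exp w)) := by
  rw [locallyIntegrable_iff]
  intro K hK
  have himg : IsCompact (Real.exp '' K) := hK.image Real.continuous_exp
  have hsub : Real.exp '' K ⊆ Ioi 0 := by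
    rintro _ ⟨w, _, rfl⟩
    exact Real.exp_pos w
  have h1 : IntegrableOn f (Real.exp '' K) :=
    hf.integrableOn_compact_subset hsub himg
  rw [integrableOn_image_iff_integrableOn_abs_deriv_smul hK.measurableSet
    (fun x _ => (Real.hasDerivAt_exp x).hasDerivWithinAt) Real.exp_injective.injOn] at h1
  -- The factor `exp (-w)`, bounded on the compact set, cancels the Jacobian.
  have h2 : IntegrableOn (fun w => Real.exp (-w) * (|Real.exp w| • f (Real.exp w))) K := by
    refine IntegrableOn.continuousOn_mul ?_ h1 hK
    fun_prop
  refine h2.congr_fun (fun w _ => ?_) hK.measurableSet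
  simp only [abs_of_pos (Real.exp_pos _), smul_eq_mul, ← mul_assoc, ← Real.exp_add]
  simp

/-- If `N (e^w) = e^w θ(w)` then `e^w N''(e^w) = θ''(w) + θ'(w)`. -/
lemma exp_mul_iteratedDeriv_two_eq {N θ : ℝ → ℝ} (hN : ContDiff ℝ (⊤ : ℕ∞) N)
    (hθ : ContDiff ℝ (⊤ : ℕ∞) θ)
    (h : ∀ w, N (Real.exp w) = Real.exp w * θ w) (w : ℝ) :
    Real.exp w * iteratedDeriv 2 N (Real.exp w) = deriv (deriv θ) w + deriv θ w := by
  have hN1 : ∀ x, HasDerivAt N (deriv N x) x := fun x =>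
    ((hN.differentiable (by simp)) x).hasDerivAt
  have hN' : ContDiff ℝ (⊤ : ℕ∞) (deriv N) := (contDiff_infty_iff_deriv.1 hN).2
  have hN2 : ∀ x, HasDerivAt (deriv N) (deriv (deriv N) x) x := fun x =>
    ((hN'.differentiable (by simp)) x).hasDerivAt
  have hθ1 : ∀ x, HasDerivAt θ (deriv θ x) x := fun x =>
    ((hθ.differentiable (by simp)) x).hasDerivAt
  have hθ' : ContDiff ℝ (⊤ : ℕ∞) (deriv θ) := (contDiff_infty_iff_deriv.1 hθ).2
  have hθ2 : ∀ x, HasDerivAt (deriv θ) (deriv (deriv θ) x) x := fun x =>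
    ((hθ'.differentiable (by simp)) x).hasDerivAt
  have e1 : ∀ w, deriv N (Real.exp w) = θ w + deriv θ w := by
    intro w
    have a1 : HasDerivAt (fun w => N (Real.exp w)) (deriv N (Real.exp w) * Real.exp w) w :=
      (hN1 _).comp w (Real.hasDerivAt_exp w)
    have a2 : HasDerivAt (fun w => Real.exp w * θ w)
        (Real.exp w * θ w + Real.exp w * deriv θ w) w :=
      (Real.hasDerivAt_exp w).mul (hθ1 w)
    rw [funext h] at a1
    have := a1.unique a2
    have hp := Real.exp_pos w
    field_simp at this
    linarith
  have a1 : HasDerivAt (fun w => deriv N (Real.exp w))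
      (deriv (deriv N) (Real.exp w) * Real.exp w) w :=
    (hN2 _).comp w (Real.hasDerivAt_exp w)
  have a2 : HasDerivAt (fun w => θ w + deriv θ w) (deriv θ w + deriv (deriv θ) w) w :=
    (hθ1 w).add (hθ2 w)
  rw [funext e1] at a1
  have := a1.unique a2
  rw [iteratedDeriv_succ, iteratedDeriv_one]
  linarith

lemma contDiff_and_hasCompactSupport_exp_mul_comp_exp {η : ℝ → ℝ}
    (hη : ContDiff ℝ (⊤ : ℕ∞) η) (hc : HasCompactSupport η) (hs : tsupport η ⊆ Ioi 0) :
    ContDiff ℝ (⊤ : ℕ∞) (fun w => Real.exp w * η (Real.exp w)) ∧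
      HasCompactSupport (fun w => Real.exp w * η (Real.exp w)) := by
  refine ⟨Real.contDiff_exp.mul (hη.comp Real.contDiff_exp), ?_⟩
  have hK : IsCompact (Real.log '' tsupport η) := by
    refine IsCompact.image_of_continuousOn hc ?_
    exact Real.continuousOn_log.mono fun x hx => (hs hx).ne'
  refine HasCompactSupport.intro hK fun w hw => ?_
  have : Real.exp w ∉ tsupport η := fun h => hw ⟨_, h, Real.log_exp w⟩
  simp [image_eq_zero_of_notMem_tsupport this]

/-- The test function on `(0, ∞)` with `e^w η(e^w) = θ(w)`. -/
def expTest (θ : ℝ → ℝ) (x : ℝ) : ℝ := if 0 < x then x⁻¹ * θ (Real.log x) else 0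

lemma exp_mul_expTest (θ : ℝ → ℝ) (w : ℝ) :
    Real.exp w * expTest θ (Real.exp w) = θ w := by
  simp [expTest, Real.exp_pos]

lemma expTest_eq_zero {θ : ℝ → ℝ} {x : ℝ} (hx : x ∉ Real.exp '' tsupport θ) :
    expTest θ x = 0 := by
  unfold expTest
  split_ifs with h
  · have : Real.log x ∉ tsupport θ := fun h' => hx ⟨_, h', Real.exp_log h⟩
    simp [image_eq_zero_of_notMem_tsupport this]
  · rfl

lemma expTest_spec {θ : ℝ → ℝ} (hθ : ContDiff ℝ (⊤ : ℕ∞) θ) (hc : HasCompactSupport θ) :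
    ContDiff ℝ (⊤ : ℕ∞) (expTest θ) ∧ HasCompactSupport (expTest θ) ∧
      tsupport (expTest θ) ⊆ Ioi 0 := by
  have hK : IsCompact (Real.exp '' tsupport θ) := IsCompact.image hc Real.continuous_exp
  have hsub : Real.exp '' tsupport θ ⊆ Ioi 0 := by
    rintro _ ⟨w, _, rfl⟩
    exact Real.exp_pos w
  refine ⟨?_, HasCompactSupport.intro hK fun x hx => expTest_eq_zero hx, ?_⟩
  · rw [contDiff_iff_contDiffAt]
    intro x
    by_cases hx : 0 < x
    · have h1 : ContDiffAt ℝ (⊤ : ℕ∞) (fun x => x⁻¹ * θ (Real.log x)) x :=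
        (contDiffAt_inv ℝ hx.ne').mul
          (hθ.contDiffAt.comp x (Real.contDiffAt_log.2 hx.ne'))
      refine h1.congr_of_eventuallyEq ?_
      filter_upwards [lt_mem_nhds hx] with y hy
      simp [expTest, hy]
    · have hx' : x ∉ Real.exp '' tsupport θ := fun h => hx (hsub h)
      have : ContDiffAt ℝ (⊤ : ℕ∞) (fun _ : ℝ => (0 : ℝ)) x := contDiffAt_const
      refine this.congr_of_eventuallyEq ?_
      filter_upwards [hK.isClosed.isOpen_compl.mem_nhds hx'] with y hy
      exact expTest_eq_zero hy
  · refine (closure_minimal (fun x hx => ?_) hK.isClosed).trans hsub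
    by_contra h
    exact hx (expTest_eq_zero h)

lemma integral_weak_eq_integral_log {σ c : ℝ} {f g η θ : ℝ → ℝ}
    (hη : ContDiff ℝ (⊤ : ℕ∞) η) (hθ : ContDiff ℝ (⊤ : ℕ∞) θ)
    (h : ∀ w, Real.exp w * η (Real.exp w) = θ w) :
    ∫ x in Ioi (0 : ℝ), (σ ^ 2 / 2 * f x * iteratedDeriv 2 (fun y => y ^ 2 * η y) x
        - c * f x * η x + g x * η x) =
      ∫ w, (f (Real.exp w) * (σ ^ 2 / 2 * (deriv (deriv θ) w + deriv θ w) - c * θ w)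
        + g (Real.exp w) * θ w) := by
  rw [integral_Ioi_eq_integral_exp]
  congr 1 with w
  have h2 := exp_mul_iteratedDeriv_two_eq (N := fun y => y ^ 2 * η y)
    ((contDiff_id.pow 2).mul hη) hθ (fun w => by rw [← h w]; ring) w
  rw [← h2, ← h w]
  ring

/-- The substitution `x = e^w` gives the Euler-type operator constant coefficients. Putting the
Jacobian into `θ(w) = e^w η(e^w)` makes test functions on `(0, ∞)` and on `ℝ` correspond
bijectively. -/
lemma isWeakSolution_iff_log {σ c : ℝ} {f g : ℝ → ℝ} (hf : LocallyIntegrableOn f (Ioi 0)) :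
    IsWeakSolution σ c g f ↔ ∀ θ : ℝ → ℝ, ContDiff ℝ (⊤ : ℕ∞) θ → HasCompactSupport θ →
      ∫ w, (f (Real.exp w) * (σ ^ 2 / 2 * (deriv (deriv θ) w + deriv θ w) - c * θ w)
        + g (Real.exp w) * θ w) = 0 := by
  constructor
  · intro hw θ hθ hc
    obtain ⟨h1, h2, h3⟩ := expTest_spec hθ hc
    rw [← integral_weak_eq_integral_log h1 hθ (exp_mul_expTest θ)]
    exact hw.weak_eq _ h1 h2 h3
  · refine fun h => ⟨hf, fun η h1 h2 h3 => ?_⟩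
    obtain ⟨h4, h5⟩ := contDiff_and_hasCompactSupport_exp_mul_comp_exp h1 h2 h3
    rw [integral_weak_eq_integral_log h1 h4 (fun _ => rfl)]
    exact h _ h4 h5

/-! ### Uniqueness of weak solutions of at most linear growth -/

lemma eq_zero_of_abs_mul_exp_le {A δ M : ℝ} (hδ : 0 < δ)
    (h : ∀ y, 0 ≤ y → |A| * Real.exp (δ * y) ≤ M) : A = 0 := by
  by_contra hA
  have hA' : 0 < |A| := abs_pos.2 hA
  -- At this point `|A| δ y = |M|`, so `exp (δ y) ≥ 1 + δ y` yields `|A| + |M| ≤ M`, which is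
  -- absurd.
  have h0 := h (|M| / (|A| * δ)) (by positivity)
  have h1 := Real.add_one_le_exp (δ * (|M| / (|A| * δ)))
  have h2 : |A| * (δ * (|M| / (|A| * δ))) = |M| := by field_simp
  nlinarith [le_abs_self M]

/-- A solution of `a (G'' - G') = c G` which is `O(1 + e^y)` vanishes. -/
lemma eq_zero_of_ode_of_growth {a c C : ℝ} (ha : 0 < a) (hc : 0 < c) {G G₁ G₂ : ℝ → ℝ}
    (h1 : ∀ y, HasDerivAt G (G₁ y) y) (h2 : ∀ y, HasDerivAt G₁ (G₂ y) y)
    (hode : ∀ y, a * (G₂ y - G₁ y) = c * G y)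
    (hb : ∀ y, |G y| ≤ C * (1 + Real.exp y)) (y : ℝ) : G y = 0 := by
  -- The roots of `p² - p = c / a` are `(1 ± r) / 2`; since `r > 1`, they lie outside `[0, 1]` on
  -- opposite sides.
  set r := √(1 + 4 * (c / a)) with hr
  have hca : 0 < c / a := by positivity
  have hr2 : r ^ 2 = 1 + 4 * (c / a) := Real.sq_sqrt (by positivity)
  have hr1 : 1 < r := by
    have : 0 ≤ r := Real.sqrt_nonneg _
    nlinarith
  have hG2 : ∀ y, G₂ y = G₁ y + c / a * G y := by
    intro y
    have := hode y
    field_simp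
    linarith
  -- The equation factors as `(∂ - p)(∂ - q) G = 0`, so `G' - q G` is a multiple of `e^{py}`. Using
  -- both orders of the roots isolates `G`.
  have key : ∀ p q : ℝ, p + q = 1 → p * q = -(c / a) →
      ∃ A, ∀ y, G₁ y - q * G y = A * Real.exp (p * y) := by
    intro p q hpq hpq'
    have hd : ∀ y, HasDerivAt (fun y => (G₁ y - q * G y) * Real.exp (-(p * y))) 0 y := by
      intro y
      have e1 : HasDerivAt (fun y => G₁ y - q * G y) (G₂ y - q * G₁ y) y :=
        (h2 y).sub ((h1 y).const_mul q)
      have e2 : HasDerivAt (fun y => Real.exp (-(p * y))) (Real.exp (-(p * y)) * (-(p * 1))) y :=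
        (((hasDerivAt_id y).const_mul p).neg).exp
      convert! e1.mul e2 using 1
      have hq : q = 1 - p := by linarith
      have : c / a = -(p * q) := by linarith
      rw [hG2, this, hq]
      ring
    refine ⟨(G₁ 0 - q * G 0), fun y => ?_⟩
    have := is_const_of_deriv_eq_zero (fun y => (hd y).differentiableAt)
      (fun y => (hd y).deriv) y 0
    simp only [mul_zero, neg_zero, Real.exp_zero, mul_one] at this
    rw [← this, mul_assoc, ← Real.exp_add]
    simp
  obtain ⟨A, hA⟩ := key ((1 + r) / 2) ((1 - r) / 2) (by ring) (by nlinarith)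
  obtain ⟨A', hA'⟩ := key ((1 - r) / 2) ((1 + r) / 2) (by ring) (by nlinarith)
  have hG : ∀ y, r * G y = A * Real.exp ((1 + r) / 2 * y) - A' * Real.exp ((1 - r) / 2 * y) := by
    intro y
    rw [← hA, ← hA']
    ring
  have hC : 0 ≤ C := by
    have := (abs_nonneg _).trans (hb 0)
    simp at this
    linarith
  -- At `+∞` this mode outgrows `e^y` by the factor `exp ((r - 1) / 2 * y)`, while the other mode
  -- stays bounded.
  have hA0 : A = 0 := by
    refine eq_zero_of_abs_mul_exp_le (δ := (r - 1) / 2) (M := r * (C * 2) + |A'|) (by linarith)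
      fun y hy => ?_
    have e1 : A * Real.exp ((1 + r) / 2 * y) = r * G y + A' * Real.exp ((1 - r) / 2 * y) := by
      linarith [hG y]
    have e2 : |A| * Real.exp ((1 + r) / 2 * y) ≤
        r * (C * (1 + Real.exp y)) + |A'| * Real.exp ((1 - r) / 2 * y) := by
      calc |A| * Real.exp ((1 + r) / 2 * y) = |A * Real.exp ((1 + r) / 2 * y)| := by
            rw [abs_mul, Real.abs_exp]
        _ ≤ |r * G y| + |A' * Real.exp ((1 - r) / 2 * y)| := by
            rw [e1]; exact abs_add_le _ _
        _ ≤ _ := by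
            rw [abs_mul, abs_mul, Real.abs_exp, abs_of_pos (by linarith : 0 < r)]
            gcongr
            exact hb y
    have e3 : Real.exp ((1 - r) / 2 * y) ≤ 1 := Real.exp_le_one_iff.2 (by nlinarith)
    have e4 : 1 ≤ Real.exp y := Real.one_le_exp hy
    have e5 : Real.exp ((1 + r) / 2 * y) = Real.exp ((r - 1) / 2 * y) * Real.exp y := by
      rw [← Real.exp_add]; ring_nf
    rw [e5, ← mul_assoc] at e2
    have e6 : |A'| * Real.exp ((1 - r) / 2 * y) ≤ |A'| * Real.exp y :=
      mul_le_mul_of_nonneg_left (e3.trans e4) (abs_nonneg _)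
    have e7 : r * (C * (1 + Real.exp y)) ≤ r * (C * 2) * Real.exp y := by
      have : 0 ≤ r * C := by positivity
      nlinarith
    have : |A| * Real.exp ((r - 1) / 2 * y) * Real.exp y ≤ (r * (C * 2) + |A'|) * Real.exp y := by
      linarith
    exact le_of_mul_le_mul_right this (Real.exp_pos y)
  -- At `-∞` the remaining mode blows up, whereas `|G| ≤ 2C` on the negative half-line.
  have hA'0 : A' = 0 := by
    refine eq_zero_of_abs_mul_exp_le (δ := (r - 1) / 2) (M := r * (C * 2)) (by linarith)
      fun y hy => ?_
    have e1 : |A'| * Real.exp ((r - 1) / 2 * y) = r * |G (-y)| := by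
      have := hG (-y)
      rw [hA0] at this
      rw [← abs_of_pos (by linarith : 0 < r), ← abs_mul, this, zero_mul, zero_sub, abs_neg,
        abs_mul, Real.abs_exp, abs_of_pos (by linarith : 0 < r)]
      ring_nf
    rw [e1]
    have e2 : Real.exp (-y) ≤ 1 := Real.exp_le_one_iff.2 (by linarith)
    have := hb (-y)
    gcongr
    nlinarith
  have := hG y
  rw [hA0, hA'0] at this
  simp at this
  exact this.resolve_left (by linarith)

/-- The integral is the mollification `G = D * χ`, whose derivatives fall on `χ`. Testing with `t ↦
χ(y - t)` turns the weak equation into `a (G'' - G') = c G`; the sign of the first-order term flips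
by reflection. As `G` inherits the growth of `D`, it vanishes. -/
lemma eq_zero_of_abs_le_of_integral_eq_zero {a c C : ℝ} (ha : 0 < a) (hc : 0 < c) {D : ℝ → ℝ}
    (hD : LocallyIntegrable D) (hb : ∀ w, |D w| ≤ C * (1 + Real.exp w))
    (h : ∀ θ : ℝ → ℝ, ContDiff ℝ (⊤ : ℕ∞) θ → HasCompactSupport θ →
      ∫ w, D w * (a * (deriv (deriv θ) w + deriv θ w) - c * θ w) = 0)
    {χ : ℝ → ℝ} (hχ : ContDiff ℝ (⊤ : ℕ∞) χ) (hχc : HasCompactSupport χ) (y : ℝ) :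
    ∫ t, D t * χ (y - t) = 0 := by
  have hχ' : ContDiff ℝ (⊤ : ℕ∞) (deriv χ) := (contDiff_infty_iff_deriv.1 hχ).2
  have hχ'' : ContDiff ℝ (⊤ : ℕ∞) (deriv (deriv χ)) := (contDiff_infty_iff_deriv.1 hχ').2
  have hint : ∀ ψ : ℝ → ℝ, ContDiff ℝ (⊤ : ℕ∞) ψ → HasCompactSupport ψ → ∀ y,
      Integrable (fun t => D t * ψ (y - t)) := by
    intro ψ hψ hψc y
    refine hD.integrable_smul_right_of_hasCompactSupport (g := fun t => ψ (y - t))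
      (hψ.continuous.comp (by fun_prop)) ?_
    exact hψc.comp_homeomorph (Homeomorph.subLeft y)
  have hder : ∀ ψ : ℝ → ℝ, ContDiff ℝ (⊤ : ℕ∞) ψ → HasCompactSupport ψ → ∀ y,
      HasDerivAt (fun y => ∫ t, D t * ψ (y - t)) (∫ t, D t * deriv ψ (y - t)) y := by
    intro ψ hψ hψc y
    exact hψc.hasDerivAt_convolution_right (ContinuousLinearMap.mul ℝ ℝ) hD
      (hψ.of_le (by exact_mod_cast le_top)) y
  refine eq_zero_of_ode_of_growth ha hc (C := C * ∫ s, (1 + Real.exp (-s)) * |χ s|)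
    (hder χ hχ hχc) (hder _ hχ' hχc.deriv) (fun y => ?_) (fun y => ?_) y
  · have hθ : ContDiff ℝ (⊤ : ℕ∞) (fun t => χ (y - t)) := hχ.comp (by fun_prop)
    have hd : ∀ ψ : ℝ → ℝ, ContDiff ℝ (⊤ : ℕ∞) ψ →
        deriv (fun t => ψ (y - t)) = fun t => -deriv ψ (y - t) := by
      intro ψ hψ
      ext t
      exact deriv_comp_const_sub ..
    have hd2 : deriv (deriv (fun t => χ (y - t))) = fun t => deriv (deriv χ) (y - t) := by
      rw [hd χ hχ]
      ext t
      rw [deriv.fun_neg, hd _ hχ']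
      simp
    have := h _ hθ (hχc.comp_homeomorph (Homeomorph.subLeft y))
    rw [hd2, hd χ hχ] at this
    have e : ∀ t, D t * (a * (deriv (deriv χ) (y - t) + -deriv χ (y - t)) - c * χ (y - t)) =
        a * (D t * deriv (deriv χ) (y - t)) - a * (D t * deriv χ (y - t))
          - c * (D t * χ (y - t)) := fun t => by ring
    simp only [e] at this
    have i1 := (hint _ hχ'' hχc.deriv.deriv y).const_mul a
    have i2 := (hint _ hχ' hχc.deriv y).const_mul a
    have i12 : Integrable fun t =>
        a * (D t * deriv (deriv χ) (y - t)) - a * (D t * deriv χ (y - t)) := i1.sub i2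
    rw [integral_sub i12 ((hint _ hχ hχc y).const_mul c), integral_sub i1 i2] at this
    simp only [integral_const_mul] at this
    linarith
  · have e1 : ∫ t, D t * χ (y - t) = ∫ s, D (y - s) * χ s := by
      rw [← integral_sub_left_eq_self _ volume y]
      simp
    have hC : 0 ≤ C := by
      have := (abs_nonneg _).trans (hb 0)
      simp at this
      linarith
    have hi : Integrable (fun s => (1 + Real.exp (-s)) * |χ s|) := by
      refine Continuous.integrable_of_hasCompactSupport ?_ ?_
      · exact (by fun_prop : Continuous fun s : ℝ => 1 + Real.exp (-s)).mul hχ.continuous.abs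
      · exact HasCompactSupport.mul_left (f := fun s => 1 + Real.exp (-s))
          (hχc.comp_left (g := fun x => |x|) abs_zero)
    rw [e1]
    calc |∫ s, D (y - s) * χ s| ≤ ∫ s, C * (1 + Real.exp y) * ((1 + Real.exp (-s)) * |χ s|) := by
          rw [← Real.norm_eq_abs]
          refine norm_integral_le_of_norm_le (hi.const_mul _) (ae_of_all _ fun s => ?_)
          rw [Real.norm_eq_abs, abs_mul, ← mul_assoc]
          refine mul_le_mul_of_nonneg_right ((hb _).trans ?_) (abs_nonneg _)
          -- The bound used is `1 + e^{y-s} ≤ (1 + e^y)(1 + e^{-s})`.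
          rw [mul_assoc, sub_eq_add_neg, Real.exp_add]
          have h1 := Real.exp_pos y
          have h2 := Real.exp_pos (-s)
          refine mul_le_mul_of_nonneg_left ?_ hC
          nlinarith
      _ = _ := by rw [integral_const_mul]; ring

lemma integrable_mul_of_locallyIntegrable {f g : ℝ → ℝ} (hf : LocallyIntegrable f)
    (hg : Continuous g) (hc : HasCompactSupport g) : Integrable (fun w => f w * g w) :=
  hf.integrable_smul_right_of_hasCompactSupport hg hc

/-- Two weak solutions of at most linear growth agree almost everywhere. -/
lemma IsWeakSolution.ae_eq {σ c C₁ C₂ : ℝ} (hσ : 0 < σ) (hc : 0 < c) {g f₁ f₂ : ℝ → ℝ}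
    (hg : ContinuousOn g (Ioi 0))
    (h₁ : IsWeakSolution σ c g f₁) (h₂ : IsWeakSolution σ c g f₂)
    (hb₁ : ∀ x, 0 < x → |f₁ x| ≤ C₁ * (1 + x)) (hb₂ : ∀ x, 0 < x → |f₂ x| ≤ C₂ * (1 + x)) :
    ∀ᵐ x ∂(volume.restrict (Ioi (0 : ℝ))), f₁ x = f₂ x := by
  have hgc : Continuous fun w => g (Real.exp w) :=
    hg.comp_continuous Real.continuous_exp fun w => Real.exp_pos w
  have l1 := locallyIntegrable_comp_exp h₁.locallyIntegrable
  have l2 := locallyIntegrable_comp_exp h₂.locallyIntegrable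
  have w1 := (isWeakSolution_iff_log h₁.locallyIntegrable).1 h₁
  have w2 := (isWeakSolution_iff_log h₂.locallyIntegrable).1 h₂
  have key : ∀ χ : ℝ → ℝ, ContDiff ℝ (⊤ : ℕ∞) χ → HasCompactSupport χ → ∀ y,
      ∫ t, (f₁ (Real.exp t) - f₂ (Real.exp t)) * χ (y - t) = 0 := by
    intro χ hχ hχc y
    refine eq_zero_of_abs_le_of_integral_eq_zero (a := σ ^ 2 / 2) (C := C₁ + C₂) (by positivity)
      hc (l1.sub l2) (fun w => ?_) (fun θ hθ hθc => ?_) hχ hχc y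
    · have := abs_sub (f₁ (Real.exp w)) (f₂ (Real.exp w))
      have a1 := hb₁ _ (Real.exp_pos w)
      have a2 := hb₂ _ (Real.exp_pos w)
      simp only [Pi.sub_apply]
      linarith
    · have hθ' : ContDiff ℝ (⊤ : ℕ∞) (deriv θ) := (contDiff_infty_iff_deriv.1 hθ).2
      have hθ'' : ContDiff ℝ (⊤ : ℕ∞) (deriv (deriv θ)) := (contDiff_infty_iff_deriv.1 hθ').2
      have hcont : Continuous fun w =>
          σ ^ 2 / 2 * (deriv (deriv θ) w + deriv θ w) - c * θ w := by
        have := hθ.continuous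
        have := hθ'.continuous
        have := hθ''.continuous
        fun_prop
      have hcs : HasCompactSupport fun w =>
          σ ^ 2 / 2 * (deriv (deriv θ) w + deriv θ w) - c * θ w := by
        have s1 : HasCompactSupport fun w => deriv (deriv θ) w + deriv θ w :=
          hθc.deriv.deriv.add hθc.deriv
        have s2 : HasCompactSupport fun w => σ ^ 2 / 2 * (deriv (deriv θ) w + deriv θ w) :=
          s1.mul_left
        have s3 : HasCompactSupport fun w => c * θ w := hθc.mul_left
        exact s2.sub s3
      have i1 := integrable_mul_of_locallyIntegrable l1 hcont hcs
      have i2 := integrable_mul_of_locallyIntegrable l2 hcont hcs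
      have ig := integrable_mul_of_locallyIntegrable hgc.locallyIntegrable hθ.continuous hθc
      have e1 := w1 θ hθ hθc
      have e2 := w2 θ hθ hθc
      rw [integral_add i1 ig] at e1
      rw [integral_add i2 ig] at e2
      simp only [Pi.sub_apply, sub_mul]
      rw [integral_sub i1 i2]
      linarith
  have hae : ∀ᵐ x, x ∈ Ioi (0 : ℝ) → (f₁ - f₂) x = 0 := by
    refine isOpen_Ioi.ae_eq_zero_of_integral_contDiff_smul_eq_zero
      (h₁.locallyIntegrable.sub h₂.locallyIntegrable) fun η hη hηc hηs => ?_
    obtain ⟨h4, h5⟩ := contDiff_and_hasCompactSupport_exp_mul_comp_exp hη hηc hηs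
    -- With this kernel the convolution at `0` is the pairing of `f₁ - f₂` with `η`, written in
    -- logarithmic coordinates.
    have := key (fun w => Real.exp (-w) * η (Real.exp (-w))) (h4.comp contDiff_neg)
      (h5.comp_homeomorph (Homeomorph.neg ℝ)) 0
    have e : ∫ x, η x • (f₁ - f₂) x = ∫ x in Ioi (0 : ℝ), η x • (f₁ - f₂) x := by
      refine (setIntegral_eq_integral_of_forall_compl_eq_zero fun x hx => ?_).symm
      simp [image_eq_zero_of_notMem_tsupport fun h => hx (hηs h)]
    rw [e, integral_Ioi_eq_integral_exp, ← this]
    congr 1 with t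
    simp
    ring
  rw [ae_restrict_iff' measurableSet_Ioi]
  filter_upwards [hae] with x hx h
  exact sub_eq_zero.1 (hx h)

/-! ### Injectivity of the Laplace transform -/

/-- An integrable function on `(0, ∞)` whose Laplace transform vanishes on `ℕ` is zero. -/
lemma ae_eq_zero_of_integral_exp_mul_eq_zero {g : ℝ → ℝ} (hg : IntegrableOn g (Ioi 0))
    (h : ∀ k : ℕ, ∫ t in Ioi (0 : ℝ), Real.exp (-(k * t)) * g t = 0) :
    ∀ᵐ t ∂(volume.restrict (Ioi (0 : ℝ))), g t = 0 := by
  have hmem : ∀ t ∈ Ioi (0 : ℝ), Real.exp (-t) ∈ Icc (0 : ℝ) 1 := fun t ht =>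
    ⟨(Real.exp_pos _).le, Real.exp_le_one_iff.2 (by simpa using (le_of_lt ht))⟩
  have hint : ∀ q : ℝ → ℝ, Continuous q →
      IntegrableOn (fun t => q (Real.exp (-t)) * g t) (Ioi 0) := by
    intro q hq
    obtain ⟨M, hM⟩ := (isCompact_Icc (a := (0 : ℝ)) (b := 1)).exists_bound_of_continuousOn
      hq.continuousOn
    refine hg.bdd_mul (c := M) ?_ ?_
    · exact (hq.comp (by fun_prop)).aestronglyMeasurable
    · exact (ae_restrict_iff' measurableSet_Ioi).2 (ae_of_all _ fun t ht => hM _ (hmem t ht))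
  have hpoly : ∀ p : Polynomial ℝ,
      ∫ t in Ioi (0 : ℝ), p.eval (Real.exp (-t)) * g t = 0 := by
    intro p
    induction p using Polynomial.induction_on' with
    | add p q hp hq =>
      simp only [Polynomial.eval_add, add_mul]
      rw [integral_add (hint _ p.continuous) (hint _ q.continuous), hp, hq, add_zero]
    | monomial n a =>
      simp only [Polynomial.eval_monomial, mul_assoc]
      rw [integral_const_mul]
      have : ∀ t : ℝ, Real.exp (-t) ^ n = Real.exp (-(n * t)) := fun t => by
        rw [← Real.exp_nat_mul]; ring_nf
      simp only [this, h n, mul_zero]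
  have hae : ∀ᵐ t, t ∈ Ioi (0 : ℝ) → g t = 0 := by
    refine isOpen_Ioi.ae_eq_zero_of_integral_contDiff_smul_eq_zero hg.locallyIntegrableOn
      fun η hη hηc hηs => ?_
    -- Here `q(s) = η(-log s)` for `s > 0` and `0` otherwise. It is continuous on `[0, 1]`, so
    -- Weierstrass approximation gives polynomials in `e^{-t}` close to `η(t)` uniformly on `t > 0`.
    set q : ℝ → ℝ := fun s => s * expTest (fun w => η (-w)) s with hq
    have hqc : Continuous q := continuous_id.mul
      (expTest_spec (hη.comp contDiff_neg) (hηc.comp_homeomorph (Homeomorph.neg ℝ))).1.continuous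
    have hqe : ∀ t, q (Real.exp (-t)) = η t := fun t => by
      rw [hq]
      simp only
      rw [exp_mul_expTest]
      simp
    have e : ∫ x, η x • g x = ∫ t in Ioi (0 : ℝ), q (Real.exp (-t)) * g t := by
      simp only [hqe]
      refine (setIntegral_eq_integral_of_forall_compl_eq_zero fun x hx => ?_).symm
      simp [image_eq_zero_of_notMem_tsupport fun h => hx (hηs h)]
    rw [e]
    by_contra hne
    set I := ∫ t in Ioi (0 : ℝ), |g t| with hI
    have hI0 : 0 ≤ I := integral_nonneg fun _ => abs_nonneg _
    -- The tolerance is the supposed nonzero value divided by `I + 1`, so that its product with `I`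
    -- stays below that value.
    obtain ⟨p, hp⟩ := exists_polynomial_near_of_continuousOn 0 1 q hqc.continuousOn
      (|∫ t in Ioi (0 : ℝ), q (Real.exp (-t)) * g t| / (I + 1))
      (by have := abs_pos.2 hne; positivity)
    set J := |∫ t in Ioi (0 : ℝ), q (Real.exp (-t)) * g t| with hJ
    have hJ0 : 0 < J := abs_pos.2 hne
    have : J ≤ J / (I + 1) * I := by
      calc J = |∫ t in Ioi (0 : ℝ), (q (Real.exp (-t)) - p.eval (Real.exp (-t))) * g t| := by
            simp only [sub_mul]
            rw [integral_sub (hint _ hqc) (hint _ p.continuous), hpoly, sub_zero]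
        _ ≤ ∫ t in Ioi (0 : ℝ), J / (I + 1) * |g t| := by
            rw [← Real.norm_eq_abs]
            refine norm_integral_le_of_norm_le (hg.abs.const_mul _)
              ((ae_restrict_iff' measurableSet_Ioi).2 (ae_of_all _ fun t ht => ?_))
            rw [Real.norm_eq_abs, abs_mul, abs_sub_comm]
            exact mul_le_mul_of_nonneg_right (hp _ (hmem t ht)).le (abs_nonneg _)
        _ = _ := by rw [integral_const_mul]
    have h3 : J / (I + 1) * I < J := by
      rw [div_mul_eq_mul_div, div_lt_iff₀ (by positivity)]
      nlinarith
    linarith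
  rwa [ae_restrict_iff' measurableSet_Ioi]

/-- Damping by `e^{-mt}` with an integer `m > l₀` makes the difference integrable, and its transform
at `k` is the original one at `m + k`. Requiring equality only at integers keeps exceptional sets in
`x` countable in number. -/
lemma ae_eq_of_timeLaplace_eq {u v : ℝ → ℝ → ℝ} {x l₀ : ℝ}
    (hu : ∀ l, l₀ < l → IntegrableOn (fun t => Real.exp (-l * t) * u t x) (Ioi 0))
    (hv : ∀ l, l₀ < l → IntegrableOn (fun t => Real.exp (-l * t) * v t x) (Ioi 0))
    (h : ∀ n : ℕ, l₀ < n → timeLaplace u n x = timeLaplace v n x) :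
    ∀ᵐ t ∂(volume.restrict (Ioi (0 : ℝ))), u t x = v t x := by
  obtain ⟨m, hm⟩ := exists_nat_gt l₀
  have := ae_eq_zero_of_integral_exp_mul_eq_zero
    (g := fun t => Real.exp (-m * t) * u t x - Real.exp (-m * t) * v t x)
    ((hu m hm).sub (hv m hm)) fun k => ?_
  · filter_upwards [this] with t ht
    rw [← mul_sub] at ht
    exact sub_eq_zero.1 ((mul_eq_zero.1 ht).resolve_left (Real.exp_ne_zero _))
  · have hk : l₀ < ((m + k : ℕ) : ℝ) := by
      push_cast
      have : (0 : ℝ) ≤ k := k.cast_nonneg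
      linarith
    have e := h (m + k) hk
    unfold timeLaplace at e
    rw [← sub_eq_zero, ← integral_sub (hu _ hk) (hv _ hk)] at e
    refine Eq.trans (integral_congr_ae (ae_of_all _ fun t => ?_)) e
    simp only
    rw [← mul_sub, ← mul_sub, ← mul_assoc, ← Real.exp_add]
    push_cast
    ring_nf

/-! ### Fourier inversion against a measure with rational characteristic function -/

open scoped FourierTransform in
-- Fourier inversion of `R` under the integral, then Fubini, justified by integrability of `𝓕 R`.
-- The argument `-(2πξ)` reflects the kernel `e^{2πiξx}`.
lemma integral_comp_sub_eq_integral_fourier_mul_charFun {μ : Measure ℝ} [IsProbabilityMeasure μ]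
    (R : SchwartzMap ℝ ℂ) (y : ℝ) :
    ∫ z, R (y - z) ∂μ = ∫ ξ, Complex.exp (↑(2 * Real.pi * (ξ * y)) * Complex.I) *
      (𝓕 (R : ℝ → ℂ) ξ * charFun μ (-(2 * Real.pi * ξ))) := by
  have hF : Integrable (𝓕 (R : ℝ → ℂ)) := by
    rw [← SchwartzMap.fourier_coe]
    exact (𝓕 R).integrable
  have hinv : ∀ x, R x = ∫ ξ, Complex.exp (↑(2 * Real.pi * (ξ * x)) * Complex.I) *
      𝓕 (R : ℝ → ℂ) ξ := by
    intro x
    have h1 := congrFun (R.continuous.fourierInv_fourier_eq R.integrable hF) x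
    rw [Real.fourierInv_eq'] at h1
    rw [← h1]
    simp [mul_comm]
  have e1 : ∀ z, R (y - z) = ∫ ξ, (Complex.exp (↑(2 * Real.pi * (ξ * y)) * Complex.I) *
      𝓕 (R : ℝ → ℂ) ξ) * Complex.exp (((-(2 * Real.pi * ξ) : ℝ) : ℂ) * z * Complex.I) := by
    intro z
    rw [hinv]
    congr 1 with ξ
    rw [mul_right_comm (Complex.exp _), ← Complex.exp_add]
    congr 2
    push_cast
    ring
  simp only [e1]
  rw [integral_integral_swap]
  · congr 1 with ξ
    rw [integral_const_mul, charFun_apply_real]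
    ring
  · have : Integrable (fun p : ℝ × ℝ => 𝓕 (R : ℝ → ℂ) p.2) (μ.prod volume) := hF.comp_snd μ
    refine (this.bdd_mul (c := 1) (f := fun p : ℝ × ℝ =>
      Complex.exp (↑(2 * Real.pi * (p.2 * y)) * Complex.I) *
        Complex.exp (((-(2 * Real.pi * p.2) : ℝ) : ℂ) * p.1 * Complex.I)) ?_ ?_).congr ?_
    · exact Continuous.aestronglyMeasurable (by fun_prop)
    · refine ae_of_all _ fun p => ?_
      rw [norm_mul, Complex.norm_exp_ofReal_mul_I, ← Complex.ofReal_mul,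
        Complex.norm_exp_ofReal_mul_I, one_mul]
    · refine ae_of_all _ fun p => ?_
      simp only [Function.uncurry]
      ring

open scoped FourierTransform in
/-- If `μ` has characteristic function `c / (c + a (ξ² + i ξ))`, then convolution with `μ`
inverts `θ ↦ θ - (a / c) (θ'' + θ')` on test functions. -/
lemma integral_comp_sub_of_charFun_eq {μ : Measure ℝ} [IsProbabilityMeasure μ] {a c : ℝ}
    (hμ : ∀ ξ : ℝ, charFun μ ξ * (c + a * (ξ ^ 2 + ξ * Complex.I)) = c)
    {θ : ℝ → ℝ} (hθ : ContDiff ℝ (⊤ : ℕ∞) θ) (hc : HasCompactSupport θ) (y : ℝ) :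
    ∫ z, (a * (deriv (deriv θ) (y - z) + deriv θ (y - z)) - c * θ (y - z)) ∂μ = -(c * θ y) := by
  set f : ℝ → ℂ := fun w => (θ w : ℂ) with hf
  have hd : ∀ ψ : ℝ → ℝ, ContDiff ℝ (⊤ : ℕ∞) ψ →
      deriv (fun w => (ψ w : ℂ)) = fun w => ((deriv ψ w : ℝ) : ℂ) := by
    intro ψ hψ
    ext w
    exact (((hψ.differentiable (by simp)) w).hasDerivAt.ofReal_comp).deriv
  have hθ' : ContDiff ℝ (⊤ : ℕ∞) (deriv θ) := (contDiff_infty_iff_deriv.1 hθ).2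
  have hf1 : deriv f = fun w => ((deriv θ w : ℝ) : ℂ) := hd θ hθ
  have hf2 : deriv (deriv f) = fun w => ((deriv (deriv θ) w : ℝ) : ℂ) := by
    rw [hf1, hd _ hθ']
  have hfs : ContDiff ℝ (⊤ : ℕ∞) f := Complex.ofRealCLM.contDiff.comp hθ
  have hfc : HasCompactSupport f := hc.comp_left (g := fun x : ℝ => (x : ℂ)) Complex.ofReal_zero
  have hfs' : ContDiff ℝ (⊤ : ℕ∞) (deriv f) := (contDiff_infty_iff_deriv.1 hfs).2
  have hfs'' : ContDiff ℝ (⊤ : ℕ∞) (deriv (deriv f)) := (contDiff_infty_iff_deriv.1 hfs').2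
  have hi0 : Integrable f := hfs.continuous.integrable_of_hasCompactSupport hfc
  have hi1 : Integrable (deriv f) := hfs'.continuous.integrable_of_hasCompactSupport hfc.deriv
  have hi2 : Integrable (deriv (deriv f)) :=
    hfs''.continuous.integrable_of_hasCompactSupport hfc.deriv.deriv
  set T : SchwartzMap ℝ ℂ := hfc.toSchwartzMap hfs with hT
  set T1 : SchwartzMap ℝ ℂ := hfc.deriv.toSchwartzMap hfs' with hT1
  set T2 : SchwartzMap ℝ ℂ := hfc.deriv.deriv.toSchwartzMap hfs'' with hT2
  have cT : (T : ℝ → ℂ) = f := rfl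
  have cT1 : (T1 : ℝ → ℂ) = deriv f := rfl
  have cT2 : (T2 : ℝ → ℂ) = deriv (deriv f) := rfl
  have F1 : 𝓕 (deriv f) = fun (x : ℝ) ↦ (2 * Real.pi * Complex.I * x) • (𝓕 f x) :=
    Real.fourier_deriv hi0 (hfs.differentiable (by simp)) hi1
  have F2 : 𝓕 (deriv (deriv f)) = fun (x : ℝ) ↦ (2 * Real.pi * Complex.I * x) • (𝓕 (deriv f) x) :=
    Real.fourier_deriv hi1 (hfs'.differentiable (by simp)) hi2
  set R : SchwartzMap ℝ ℂ := a • T2 + a • T1 - c • T with hR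
  have cR : ∀ w, R w = ((a * (deriv (deriv θ) w + deriv θ w) - c * θ w : ℝ) : ℂ) := by
    intro w
    have : R w = a • T2 w + a • T1 w - c • T w := rfl
    rw [this, cT, cT1, cT2, hf2, hf1, hf]
    simp only [Complex.real_smul]
    push_cast
    ring
  have FR : ∀ ξ, 𝓕 (R : ℝ → ℂ) ξ = (a * ((2 * Real.pi * Complex.I * ξ) ^ 2 +
      2 * Real.pi * Complex.I * ξ) - c) * 𝓕 f ξ := by
    intro ξ
    rw [← SchwartzMap.fourier_coe]
    have : 𝓕 R = a • 𝓕 T2 + a • 𝓕 T1 - c • 𝓕 T := by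
      rw [hR, sub_eq_add_neg, FourierTransform.fourier_add, FourierTransform.fourier_add,
        FourierTransform.fourier_neg, FourierTransform.fourier_smul,
        FourierTransform.fourier_smul, FourierTransform.fourier_smul, sub_eq_add_neg]
    rw [this]
    have : (a • 𝓕 T2 + a • 𝓕 T1 - c • 𝓕 T) ξ = a • 𝓕 T2 ξ + a • 𝓕 T1 ξ - c • 𝓕 T ξ := rfl
    rw [this, SchwartzMap.fourier_coe, SchwartzMap.fourier_coe, SchwartzMap.fourier_coe, cT, cT1,
      cT2, F2, F1]
    simp only [Complex.real_smul, smul_eq_mul]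
    ring
  have key := integral_comp_sub_eq_integral_fourier_mul_charFun (μ := μ) R y
  have hinv : f y = ∫ ξ, Complex.exp (↑(2 * Real.pi * (ξ * y)) * Complex.I) * 𝓕 f ξ := by
    have hF : Integrable (𝓕 f) := by
      rw [← cT, ← SchwartzMap.fourier_coe]
      exact (𝓕 T).integrable
    have h1 := congrFun (hfs.continuous.fourierInv_fourier_eq hi0 hF) y
    rw [Real.fourierInv_eq'] at h1
    rw [← h1]
    simp [mul_comm]
  -- At frequency `s = -2πξ` the symbol of the operator is `-(c + a (s² + i s))`, so the
  -- characteristic function reduces it to the constant `-c`.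
  have e2 : ∀ ξ, 𝓕 (R : ℝ → ℂ) ξ * charFun μ (-(2 * Real.pi * ξ)) = -c * 𝓕 f ξ := by
    intro ξ
    have := hμ (-(2 * Real.pi * ξ))
    rw [FR]
    push_cast at this ⊢
    linear_combination (-𝓕 f ξ) * this +
      (a * 𝓕 f ξ * charFun μ (-(2 * Real.pi * ξ)) * (4 * Real.pi ^ 2 * ξ ^ 2)) * Complex.I_sq
  simp only [e2, cR] at key
  have e3 : ∀ ξ : ℝ, Complex.exp (↑(2 * Real.pi * (ξ * y)) * Complex.I) * (-c * 𝓕 f ξ) =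
      -c * (Complex.exp (↑(2 * Real.pi * (ξ * y)) * Complex.I) * 𝓕 f ξ) := fun ξ => by ring
  simp only [e3] at key
  rw [integral_const_mul, ← hinv, integral_complex_ofReal] at key
  have : ((∫ z, (a * (deriv (deriv θ) (y - z) + deriv θ (y - z)) - c * θ (y - z)) ∂μ : ℝ) : ℂ) =
      ((-(c * θ y) : ℝ) : ℂ) := by
    rw [key, hf]
    push_cast
    ring
  exact_mod_cast this

/-- If `μ` has characteristic function `c / (c + (σ² / 2) (ξ² + i ξ))` and exponential moment of
order one, then `x ↦ b ∫ h(x e^z) μ(dz)` solves `(σ² / 2) x² f'' - c f + c b h = 0` weakly. -/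
lemma isWeakSolution_integral {μ : Measure ℝ} [IsProbabilityMeasure μ] {σ c b : ℝ}
    (hμ : ∀ ξ : ℝ, charFun μ ξ * (c + (σ ^ 2 / 2 : ℝ) * (ξ ^ 2 + ξ * Complex.I)) = c)
    (hexp : Integrable Real.exp μ) {h : ℝ → ℝ} (hh : Continuous h)
    (hb : ∀ x, 0 < x → |h x| ≤ x)
    (hloc : LocallyIntegrableOn (fun x => b * ∫ z, h (x * Real.exp z) ∂μ) (Ioi 0)) :
    IsWeakSolution σ c (fun x => c * b * h x) (fun x => b * ∫ z, h (x * Real.exp z) ∂μ) := by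
  refine (isWeakSolution_iff_log hloc).2 fun θ hθ hc => ?_
  have hθ' : ContDiff ℝ (⊤ : ℕ∞) (deriv θ) := (contDiff_infty_iff_deriv.1 hθ).2
  have hθ'' : ContDiff ℝ (⊤ : ℕ∞) (deriv (deriv θ)) := (contDiff_infty_iff_deriv.1 hθ').2
  set ρ : ℝ → ℝ := fun w => σ ^ 2 / 2 * (deriv (deriv θ) w + deriv θ w) - c * θ w with hρ
  have hρc : Continuous ρ := by
    have := hθ.continuous
    have := hθ'.continuous
    have := hθ''.continuous
    fun_prop
  have hρs : HasCompactSupport ρ := by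
    have s1 : HasCompactSupport fun w => deriv (deriv θ) w + deriv θ w :=
      hc.deriv.deriv.add hc.deriv
    have s2 : HasCompactSupport fun w => σ ^ 2 / 2 * (deriv (deriv θ) w + deriv θ w) :=
      s1.mul_left
    have s3 : HasCompactSupport fun w => c * θ w := hc.mul_left
    exact s2.sub s3
  have hi : Integrable (fun w => Real.exp w * ρ w) :=
    (Real.continuous_exp.mul hρc).integrable_of_hasCompactSupport hρs.mul_left
  -- This shear moves the translation from `h` to `ρ` and transfers integrability from `hK1` to
  -- `hK2`.
  have hT : MeasurePreserving (fun p : ℝ × ℝ => (p.1, p.1 + p.2)) (μ.prod volume)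
      (μ.prod volume) := measurePreserving_prod_add μ volume
  have hK1 : Integrable (fun p : ℝ × ℝ => h (Real.exp (p.1 + p.2)) * ρ p.2)
      (μ.prod volume) := by
    -- The linear bound on `h` gives `|h(e^{z+w})| ≤ e^z e^w`, a product in which the exponential
    -- moment controls `z` and compact support controls `w`.
    refine (hexp.mul_prod hi).mono (Continuous.aestronglyMeasurable (by fun_prop))
      (ae_of_all _ fun p => ?_)
    rw [norm_mul, norm_mul, norm_mul, ← mul_assoc, Real.norm_eq_abs, Real.norm_eq_abs (Real.exp _),
      Real.norm_eq_abs (Real.exp _), Real.abs_exp, Real.abs_exp, ← Real.exp_add]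
    exact mul_le_mul_of_nonneg_right (hb _ (Real.exp_pos _)) (norm_nonneg _)
  have hK2 : Integrable (fun p : ℝ × ℝ => h (Real.exp p.2) * ρ (p.2 - p.1))
      (μ.prod volume) := by
    rw [← hT.integrable_comp (Continuous.aestronglyMeasurable (by fun_prop))]
    refine hK1.congr (ae_of_all _ fun p => ?_)
    simp
  have e1 : ∫ w, (b * ∫ z, h (Real.exp w * Real.exp z) ∂μ) * ρ w =
      b * ∫ y, h (Real.exp y) * -(c * θ y) := by
    calc ∫ w, (b * ∫ z, h (Real.exp w * Real.exp z) ∂μ) * ρ w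
        = b * ∫ w, ∫ z, h (Real.exp (z + w)) * ρ w ∂μ := by
          rw [← integral_const_mul]
          congr 1 with w
          rw [integral_mul_const, mul_assoc]
          simp only [← Real.exp_add, add_comm w]
      _ = b * ∫ z, (∫ w, h (Real.exp (z + w)) * ρ w) ∂μ := by
          rw [integral_integral_swap (μ := μ) (f := fun z w => h (Real.exp (z + w)) * ρ w) hK1]
      _ = b * ∫ z, (∫ y, h (Real.exp y) * ρ (y - z)) ∂μ := by
          congr 2 with z
          rw [← integral_add_left_eq_self (fun y => h (Real.exp y) * ρ (y - z)) z]
          simp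
      _ = b * ∫ y, ∫ z, h (Real.exp y) * ρ (y - z) ∂μ := by
          rw [integral_integral_swap (μ := μ) (f := fun z y => h (Real.exp y) * ρ (y - z)) hK2]
      _ = _ := by
          congr 2 with y
          rw [integral_const_mul, integral_comp_sub_of_charFun_eq hμ hθ hc y]
  have i2 : Integrable fun w => c * b * h (Real.exp w) * θ w := by
    have : Continuous fun w => c * b * h (Real.exp w) := by fun_prop
    exact (this.mul hθ.continuous).integrable_of_hasCompactSupport hc.mul_left
  have i1 : Integrable fun w => (b * ∫ z, h (Real.exp w * Real.exp z) ∂μ) * ρ w :=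
    integrable_mul_of_locallyIntegrable (locallyIntegrable_comp_exp hloc) hρc hρs
  rw [integral_add i1 i2, e1, ← integral_const_mul, ← integral_add]
  · simp only [mul_neg]
    rw [← integral_zero ℝ ℝ]
    congr 1 with w
    ring
  · refine Integrable.const_mul ?_ b
    have : Continuous fun y => h (Real.exp y) := by fun_prop
    exact integrable_mul_of_locallyIntegrable this.locallyIntegrable
      (continuous_const.mul hθ.continuous).neg (hc.mul_left (f := fun _ => c)).neg
  · exact i2

/-! ### Exponential distributions and the Black–Scholes price -/

lemma integral_expMeasure {E : Type*} [NormedAddCommGroup E] [NormedSpace ℝ E] {c : ℝ}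
    (hc : 0 < c) (f : ℝ → E) :
    ∫ r, f r ∂(expMeasure c) = ∫ r in Ioi (0 : ℝ), (c * Real.exp (-(c * r))) • f r := by
  have h1 : expMeasure c = volume.withDensity (exponentialPDF c) := rfl
  have hm : Measurable (exponentialPDF c) := (measurable_exponentialPDFReal c).ennreal_ofReal
  rw [h1, integral_withDensity_eq_integral_toReal_smul hm
    (ae_of_all _ fun x => ENNReal.ofReal_lt_top), ← integral_Ici_eq_integral_Ioi,
    ← integral_indicator measurableSet_Ici]
  congr 1 with r
  by_cases hr : 0 ≤ r
  · rw [indicator_of_mem (by exact hr), exponentialPDF_of_nonneg hr,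
      ENNReal.toReal_ofReal (by positivity)]
  · rw [indicator_of_notMem (by exact hr), exponentialPDF_of_neg (not_le.1 hr)]
    simp

lemma expMeasure_Iio_zero (c : ℝ) : expMeasure c (Iio 0) = 0 := by
  have h1 : expMeasure c = volume.withDensity (exponentialPDF c) := rfl
  rw [h1, withDensity_apply _ measurableSet_Iio]
  exact lintegral_exponentialPDF_of_nonpos le_rfl

lemma ae_nonneg_expMeasure (c : ℝ) : ∀ᵐ r ∂(expMeasure c), 0 ≤ r := by
  rw [ae_iff]
  simp only [not_le]
  exact expMeasure_Iio_zero c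

lemma expMeasure_Ioi {c : ℝ} (hc : 0 < c) {x : ℝ} (hx : 0 ≤ x) :
    expMeasure c (Ioi x) = ENNReal.ofReal (Real.exp (-(c * x))) := by
  have := isProbabilityMeasure_expMeasure hc
  have h := cdf_expMeasure_eq hc x
  rw [if_pos hx, cdf_eq_real] at h
  rw [← compl_Iic, ← ofReal_measureReal, probReal_compl_eq_one_sub measurableSet_Iic, h]
  simp

/-- The density `exp (σ √r z - σ² r / 2)` of geometric Brownian motion in terms of a standard
normal variable. -/
def bsFactor (σ r z : ℝ) : ℝ := Real.exp (σ * (√r * z) - σ ^ 2 / 2 * r)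

lemma bsFactor_pos (σ r z : ℝ) : 0 < bsFactor σ r z := Real.exp_pos _

lemma continuous_bsFactor (σ : ℝ) : Continuous fun p : ℝ × ℝ => bsFactor σ p.1 p.2 := by
  unfold bsFactor
  fun_prop

lemma integrable_bsFactor (σ r : ℝ) : Integrable (bsFactor σ r) (gaussianReal 0 1) := by
  have := (integrable_exp_mul_gaussianReal (μ := 0) (v := 1) (σ * √r)).mul_const
    (Real.exp (-(σ ^ 2 / 2 * r)))
  refine this.congr (ae_of_all _ fun z => ?_)
  simp only [bsFactor, ← Real.exp_add]
  ring_nf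

lemma integral_bsFactor (σ : ℝ) {r : ℝ} (hr : 0 ≤ r) :
    ∫ z, bsFactor σ r z ∂(gaussianReal 0 1) = 1 := by
  have h := congrFun (mgf_id_gaussianReal (μ := 0) (v := 1)) (σ * √r)
  unfold mgf at h
  have e : ∀ z, bsFactor σ r z = Real.exp (σ * √r * id z) * Real.exp (-(σ ^ 2 / 2 * r)) := by
    intro z
    simp only [bsFactor, ← Real.exp_add, id]
    ring_nf
  simp only [e]
  rw [integral_mul_const, h, ← Real.exp_add, mul_pow, Real.sq_sqrt hr]
  simp
  ring

lemma continuous_callPayoff (K : ℝ) : Continuous (callPayoff K) := by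
  unfold callPayoff
  fun_prop

lemma callPayoff_nonneg (K x : ℝ) : 0 ≤ callPayoff K x := le_max_right _ _

lemma callPayoff_le {K x : ℝ} (hK : 0 ≤ K) (hx : 0 ≤ x) : callPayoff K x ≤ x :=
  max_le (by linarith) hx

lemma abs_callPayoff_sub_le (K x y : ℝ) : |callPayoff K x - callPayoff K y| ≤ |x - y| := by
  refine (abs_max_sub_max_le_abs _ _ _).trans_eq ?_
  ring_nf

lemma callPayoff_eq_add (K x : ℝ) : callPayoff K x = max (K - x) 0 + (x - K) := by
  unfold callPayoff
  rcases le_total x K with h | h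
  · rw [max_eq_right (by linarith), max_eq_left (by linarith)]; ring
  · rw [max_eq_left (by linarith), max_eq_right (by linarith)]; ring

/-- The Black–Scholes value `E[(x exp (σ √r Z - σ² r / 2) - K)⁺]`, `Z` standard normal. -/
def bsValue (σ K r x : ℝ) : ℝ := ∫ z, callPayoff K (x * bsFactor σ r z) ∂(gaussianReal 0 1)

lemma integrable_callPayoff_bsFactor {σ K r x : ℝ} (hK : 0 ≤ K) (hx : 0 ≤ x) :
    Integrable (fun z => callPayoff K (x * bsFactor σ r z)) (gaussianReal 0 1) := by
  refine ((integrable_bsFactor σ r).const_mul x).mono' ?_ (ae_of_all _ fun z => ?_)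
  · refine Continuous.aestronglyMeasurable ((continuous_callPayoff K).comp ?_)
    exact continuous_const.mul ((continuous_bsFactor σ).comp (Continuous.prodMk_right r))
  · rw [Real.norm_eq_abs, abs_of_nonneg (callPayoff_nonneg _ _)]
    exact callPayoff_le hK (mul_nonneg hx (bsFactor_pos _ _ _).le)

lemma bsValue_nonneg (σ K r x : ℝ) : 0 ≤ bsValue σ K r x :=
  integral_nonneg fun _ => callPayoff_nonneg _ _

lemma bsValue_le {σ K r x : ℝ} (hK : 0 ≤ K) (hr : 0 ≤ r) (hx : 0 ≤ x) :
    bsValue σ K r x ≤ x := by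
  calc bsValue σ K r x ≤ ∫ z, x * bsFactor σ r z ∂(gaussianReal 0 1) := by
        refine integral_mono (integrable_callPayoff_bsFactor hK hx)
          ((integrable_bsFactor σ r).const_mul x) fun z => ?_
        exact callPayoff_le hK (mul_nonneg hx (bsFactor_pos _ _ _).le)
    _ = x := by rw [integral_const_mul, integral_bsFactor σ hr, mul_one]

/-- The payoff is 1-Lipschitz and the factor multiplying `x` has mean one. -/
lemma abs_bsValue_sub_le {σ K r x y : ℝ} (hK : 0 ≤ K) (hr : 0 ≤ r) (hx : 0 ≤ x) (hy : 0 ≤ y) :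
    |bsValue σ K r x - bsValue σ K r y| ≤ |x - y| := by
  unfold bsValue
  rw [← integral_sub (integrable_callPayoff_bsFactor hK hx) (integrable_callPayoff_bsFactor hK hy)]
  calc _ ≤ ∫ z, |x - y| * bsFactor σ r z ∂(gaussianReal 0 1) := by
        rw [← Real.norm_eq_abs]
        refine norm_integral_le_of_norm_le ((integrable_bsFactor σ r).const_mul _)
          (ae_of_all _ fun z => ?_)
        rw [Real.norm_eq_abs]
        refine (abs_callPayoff_sub_le _ _ _).trans_eq ?_
        rw [← sub_mul, abs_mul, abs_of_pos (bsFactor_pos _ _ _)]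
    _ = |x - y| := by rw [integral_const_mul, integral_bsFactor σ hr, mul_one]

lemma bsValue_zero (σ K x : ℝ) : bsValue σ K 0 x = callPayoff K x := by
  simp [bsValue, bsFactor]

/-- Put–call parity: the call differs from the put by a term of constant mean `x - K`, and the put
payoff is bounded by `|K|`, so dominated convergence applies to it. -/
lemma continuous_bsValue {σ K x : ℝ} (hx : 0 ≤ x) :
    Continuous fun r : ℝ≥0 => bsValue σ K r x := by
  have hput : ∀ r : ℝ≥0, bsValue σ K r x =
      ∫ z, max (K - x * bsFactor σ r z) 0 ∂(gaussianReal 0 1) + (x - K) := by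
    intro r
    have hi : Integrable (fun z => x * bsFactor σ r z - K) (gaussianReal 0 1) :=
      ((integrable_bsFactor σ r).const_mul x).sub (integrable_const K)
    have hp : Integrable (fun z => max (K - x * bsFactor σ r z) 0) (gaussianReal 0 1) := by
      refine Integrable.congr hi.neg.pos_part (ae_of_all _ fun z => ?_)
      simp
    unfold bsValue
    simp only [callPayoff_eq_add K]
    rw [integral_add hp hi, integral_sub ((integrable_bsFactor σ r).const_mul x)
      (integrable_const K), integral_const_mul, integral_bsFactor σ r.coe_nonneg]
    simp
  simp only [hput]
  refine Continuous.add ?_ continuous_const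
  refine continuous_of_dominated (bound := fun _ => |K|) (fun r => ?_)
    (fun r => ae_of_all _ fun z => ?_) (integrable_const _) (ae_of_all _ fun z => ?_)
  · have := (continuous_bsFactor σ).comp (Continuous.prodMk_right (r : ℝ))
    exact Continuous.aestronglyMeasurable ((continuous_const.sub (continuous_const.mul this)).max
      continuous_const)
  · rw [Real.norm_eq_abs, abs_of_nonneg (le_max_right _ _)]
    have := mul_nonneg hx (bsFactor_pos σ r z).le
    exact max_le (by linarith [le_abs_self K]) (abs_nonneg K)
  · have : Continuous fun r : ℝ≥0 => bsFactor σ r z :=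
      (continuous_bsFactor σ).comp (NNReal.continuous_coe.prodMk continuous_const)
    exact (continuous_const.sub (continuous_const.mul this)).max continuous_const

/-! ### The law of drifted Brownian motion at an independent exponential time -/

/-- The law of `σ B_e - σ² e / 2` at an independent exponential time `e` of rate `c`. -/
def bsExpLaw (σ c : ℝ) : Measure ℝ :=
  ((expMeasure c).prod (gaussianReal 0 1)).map fun p => σ * (√p.1 * p.2) - σ ^ 2 / 2 * p.1

lemma measurable_logFactor (σ : ℝ) :
    Measurable fun p : ℝ × ℝ => σ * (√p.1 * p.2) - σ ^ 2 / 2 * p.1 := by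
  fun_prop

lemma isProbabilityMeasure_bsExpLaw (σ : ℝ) {c : ℝ} (hc : 0 < c) :
    IsProbabilityMeasure (bsExpLaw σ c) := by
  have := isProbabilityMeasure_expMeasure hc
  exact Measure.isProbabilityMeasure_map (measurable_logFactor σ).aemeasurable

lemma integrable_bsFactor_prod (σ : ℝ) {c : ℝ} (hc : 0 < c) :
    Integrable (fun p : ℝ × ℝ => bsFactor σ p.1 p.2) ((expMeasure c).prod (gaussianReal 0 1)) := by
  have := isProbabilityMeasure_expMeasure hc
  rw [integrable_prod_iff (continuous_bsFactor σ).aestronglyMeasurable]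
  refine ⟨ae_of_all _ fun r => integrable_bsFactor σ r, ?_⟩
  refine (integrable_const (1 : ℝ)).congr ?_
  filter_upwards [ae_nonneg_expMeasure c] with r hr
  rw [← integral_bsFactor σ hr]
  congr 1 with z
  rw [Real.norm_eq_abs, abs_of_pos (bsFactor_pos _ _ _)]

lemma integrable_exp_bsExpLaw (σ : ℝ) {c : ℝ} (hc : 0 < c) :
    Integrable Real.exp (bsExpLaw σ c) := by
  rw [bsExpLaw, integrable_map_measure Real.continuous_exp.aestronglyMeasurable
    (measurable_logFactor σ).aemeasurable]
  exact integrable_bsFactor_prod σ hc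

lemma integral_bsValue_expMeasure {σ K c x : ℝ} (hK : 0 ≤ K) (hc : 0 < c) (hx : 0 ≤ x) :
    ∫ r, bsValue σ K r x ∂(expMeasure c) = ∫ z, callPayoff K (x * Real.exp z) ∂(bsExpLaw σ c) := by
  have := isProbabilityMeasure_expMeasure hc
  have hcont : Continuous fun z => callPayoff K (x * Real.exp z) :=
    (continuous_callPayoff K).comp (by fun_prop)
  rw [bsExpLaw, integral_map (measurable_logFactor σ).aemeasurable hcont.aestronglyMeasurable,
    integral_prod]
  · rfl
  · refine ((integrable_bsFactor_prod σ hc).const_mul x).mono' ?_ (ae_of_all _ fun p => ?_)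
    · exact (hcont.measurable.comp (measurable_logFactor σ)).aestronglyMeasurable
    · rw [Real.norm_eq_abs, abs_of_nonneg (callPayoff_nonneg _ _)]
      exact callPayoff_le hK (mul_nonneg hx (bsFactor_pos _ _ _).le)

/-- Given the time `r`, the Gaussian characteristic function is `exp(-(σ²/2)(ξ² + iξ) r)`. Averaging
it over the exponential law yields `c / q`, where `q` has positive real part. -/
lemma charFun_bsExpLaw (σ : ℝ) {c : ℝ} (hc : 0 < c) (ξ : ℝ) :
    charFun (bsExpLaw σ c) ξ * (c + (σ ^ 2 / 2 : ℝ) * (ξ ^ 2 + ξ * Complex.I)) = c := by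
  have := isProbabilityMeasure_expMeasure hc
  set q : ℂ := c + (σ ^ 2 / 2 : ℝ) * (ξ ^ 2 + ξ * Complex.I) with hq
  have hqre : 0 < q.re := by
    have : q.re = c + σ ^ 2 / 2 * ξ ^ 2 := by
      simp [hq, pow_two]
    rw [this]
    positivity
  have hinner : ∀ r : ℝ, 0 ≤ r →
      ∫ z, Complex.exp (ξ * ((σ * (√r * z) - σ ^ 2 / 2 * r : ℝ) : ℂ) * Complex.I)
        ∂(gaussianReal 0 1) = Complex.exp ((c - q) * r) := by
    intro r hr
    have e : ∀ z : ℝ, Complex.exp (ξ * ((σ * (√r * z) - σ ^ 2 / 2 * r : ℝ) : ℂ) * Complex.I) =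
        Complex.exp (((ξ * σ * √r : ℝ) : ℂ) * z * Complex.I) *
          Complex.exp (-(ξ * (σ ^ 2 / 2 * r : ℝ) * Complex.I)) := by
      intro z
      rw [← Complex.exp_add]
      congr 1
      push_cast
      ring
    simp only [e]
    rw [integral_mul_const, ← charFun_apply_real, charFun_gaussianReal, ← Complex.exp_add]
    congr 1
    have hs : ((√r : ℝ) : ℂ) ^ 2 = r := by
      rw [← Complex.ofReal_pow, Real.sq_sqrt hr]
    rw [hq]
    push_cast
    linear_combination (-(ξ ^ 2 * σ ^ 2 / 2 : ℂ)) * hs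
  have h1 : charFun (bsExpLaw σ c) ξ = ∫ r, Complex.exp ((c - q) * r) ∂(expMeasure c) := by
    rw [charFun_apply_real, bsExpLaw, integral_map (measurable_logFactor σ).aemeasurable
      (Continuous.aestronglyMeasurable (by fun_prop)), integral_prod]
    · refine integral_congr_ae ?_
      filter_upwards [ae_nonneg_expMeasure c] with r hr
      exact hinner r hr
    · refine (integrable_const (1 : ℝ)).mono' ?_ (ae_of_all _ fun p => ?_)
      · exact Measurable.aestronglyMeasurable (by fun_prop)
      · rw [← Complex.ofReal_mul, Complex.norm_exp_ofReal_mul_I]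
  have h2 : ∀ r : ℝ, (c * Real.exp (-(c * r))) • Complex.exp ((c - q) * r) =
      c * Complex.exp (-q * r) := by
    intro r
    rw [Complex.real_smul]
    push_cast
    rw [mul_assoc, ← Complex.exp_add]
    ring_nf
  rw [h1, integral_expMeasure hc]
  simp only [h2]
  rw [integral_const_mul, integral_exp_mul_complex_Ioi (by simpa using hqre)]
  have hq0 : q ≠ 0 := fun h => by simp [h] at hqre
  simp
  field_simp

lemma exists_nnrat_between {a b : ℝ≥0} (hab : a < b) :
    ∃ q : ℚ≥0, a < (q : ℝ≥0) ∧ (q : ℝ≥0) < b := by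
  obtain ⟨q, h0, h1, h2⟩ := (NNReal.lt_iff_exists_rat_btwn a b).1 hab
  lift q to ℚ≥0 using h0
  have e : Real.toNNReal ((q : ℚ) : ℝ) = (q : ℝ≥0) := by
    ext
    rw [Real.coe_toNNReal _ (Rat.cast_nonneg.2 q.coe_nonneg)]
    simp
    rfl
  exact ⟨q, by rwa [← e], by rwa [← e]⟩

/-! ### Inverses of strictly increasing paths -/

/-- A path of a strictly increasing subordinator. -/
structure IsGoodPath (s : ℝ≥0 → ℝ) : Prop where
  strictMono : StrictMono s
  rightCont : ∀ t, ContinuousWithinAt s (Ici t) t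
  zero : s 0 = 0
  unbounded : ∀ M : ℝ, ∃ r, M < s r

/-- The inverse `t ↦ inf {r : s r > t}` of a path. -/
def pathInv (s : ℝ≥0 → ℝ) (t : ℝ) : ℝ≥0 := sInf {r : ℝ≥0 | t < s r}

/-- A version of the inverse which only looks at the path on the rationals. -/
def ratPathInv (t : ℝ) (s : ℝ≥0 → ℝ) : ℝ≥0 :=
  (⨅ q : ℚ≥0, if t < s (q : ℝ≥0) then (((q : ℝ≥0) : ℝ≥0∞)) else ∞).toNNReal

/-- A countable infimum gives joint measurability in time and path, which is needed for Fubini at a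
random time and for the independence of `L_t` and `B`. -/
lemma measurable_ratPathInv : Measurable fun p : ℝ × (ℝ≥0 → ℝ) => ratPathInv p.1 p.2 := by
  unfold ratPathInv
  refine ENNReal.measurable_toNNReal.comp (Measurable.iInf fun q => ?_)
  refine Measurable.ite (measurableSet_lt measurable_fst ?_) measurable_const measurable_const
  exact (measurable_pi_apply _).comp measurable_snd

lemma le_of_lt_pathInv {s : ℝ≥0 → ℝ} {r : ℝ≥0} {t : ℝ} (h : r < pathInv s t) : s r ≤ t := by
  by_contra h'
  exact absurd h (not_lt.2 (csInf_le (OrderBot.bddBelow _) (not_le.1 h')))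

namespace IsGoodPath

variable {s : ℝ≥0 → ℝ} (hs : IsGoodPath s)
include hs

lemma pathInv_apply (r : ℝ≥0) : pathInv s (s r) = r := by
  have : {r' : ℝ≥0 | s r < s r'} = Ioi r := by
    ext r'
    exact hs.strictMono.lt_iff_lt
  rw [pathInv, this, csInf_Ioi]

lemma nonempty (t : ℝ) : {r : ℝ≥0 | t < s r}.Nonempty := hs.unbounded t

lemma monotone_pathInv : Monotone (pathInv s) := fun _ t' h =>
  csInf_le_csInf (OrderBot.bddBelow _) (hs.nonempty t') fun _ hr => lt_of_le_of_lt h hr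

/-- A monotone surjection has no jumps; strict increase of `s` gives surjectivity. -/
lemma continuous_pathInv : Continuous (pathInv s) :=
  hs.monotone_pathInv.continuous_of_surjective fun r => ⟨s r, hs.pathInv_apply r⟩

lemma pathInv_zero : pathInv s 0 = 0 := by
  conv_lhs => rw [← hs.zero]
  exact hs.pathInv_apply 0

/-- Right-continuity keeps the path below `t` a little beyond `r`. With `le_of_lt_pathInv` this
traps `{t | r < L_t}` between `{t | s r < t}` and `{t | s r ≤ t}`. -/
lemma lt_pathInv_of_lt {r : ℝ≥0} {t : ℝ} (h : s r < t) : r < pathInv s t := by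
  have h1 : ∀ᶠ r' in 𝓝[>] r, s r' < t :=
    ((hs.rightCont r).mono Ioi_subset_Ici_self).eventually_lt_const h
  obtain ⟨r', h2, h3⟩ := (h1.and self_mem_nhdsWithin).exists
  refine lt_of_lt_of_le h3 (le_csInf (hs.nonempty t) fun q hq => ?_)
  exact (hs.strictMono.lt_iff_lt.1 (h2.trans hq)).le

lemma ratPathInv_eq (t : ℝ) : ratPathInv t s = pathInv s t := by
  have : (⨅ q : ℚ≥0, if t < s (q : ℝ≥0) then (((q : ℝ≥0) : ℝ≥0∞)) else ∞) =
      (pathInv s t : ℝ≥0∞) := by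
    refine le_antisymm (le_of_forall_gt fun b hb => ?_) (le_iInf fun q => ?_)
    · obtain ⟨r, hr1, hr2⟩ := ENNReal.lt_iff_exists_nnreal_btwn.1 hb
      rw [ENNReal.coe_lt_coe] at hr1
      obtain ⟨r', hr'1, hr'2⟩ := exists_lt_of_csInf_lt (hs.nonempty t) hr1
      obtain ⟨q, hq1, hq2⟩ := exists_nnrat_between hr'2
      refine lt_of_le_of_lt (iInf_le _ q) ?_
      have h4 : t < s r' := hr'1
      rw [if_pos (h4.trans (hs.strictMono hq1))]
      exact (ENNReal.coe_lt_coe.2 hq2).trans hr2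
    · split_ifs with h
      · exact ENNReal.coe_le_coe.2 (csInf_le (OrderBot.bddBelow _) h)
      · exact le_top
  rw [ratPathInv, this, ENNReal.toNNReal_coe]

end IsGoodPath

/-- Almost sure inequalities are available simultaneously only at countably many times;
right-continuity extends them. Strictness survives by placing two rationals `p < q` between `a` and
`b`. -/
lemma strictMono_of_strictMono_rat {s : ℝ≥0 → ℝ}
    (hs : ∀ p q : ℚ≥0, p < q → s (p : ℝ≥0) < s (q : ℝ≥0))
    (hr : ∀ t, ContinuousWithinAt s (Ici t) t) : StrictMono s := by
  have hlim : ∀ (a : ℝ≥0) (U : Set ℝ), U ∈ 𝓝 (s a) → ∀ b, a < b →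
      ∃ q : ℚ≥0, a < (q : ℝ≥0) ∧ (q : ℝ≥0) < b ∧ s q ∈ U := by
    intro a U hU b hab
    have h1 : ∀ᶠ r' in 𝓝[>] a, s r' ∈ U := ((hr a).mono Ioi_subset_Ici_self) hU
    obtain ⟨u, hu, hsub⟩ := (mem_nhdsGT_iff_exists_Ioo_subset' hab).1 h1
    obtain ⟨q, hq1, hq2⟩ := exists_nnrat_between (lt_min hu hab)
    exact ⟨q, hq1, hq2.trans_le (min_le_right _ _), hsub ⟨hq1, hq2.trans_le (min_le_left _ _)⟩⟩
  have hle : ∀ (a : ℝ≥0) (p : ℚ≥0), a < (p : ℝ≥0) → s a ≤ s p := by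
    intro a p hap
    by_contra h
    obtain ⟨q, _, h2, h3⟩ := hlim a _ (lt_mem_nhds (not_le.1 h)) p hap
    exact absurd (hs q p (by exact_mod_cast h2)) (not_lt.2 (le_of_lt h3))
  have hge : ∀ (a : ℝ≥0) (p : ℚ≥0), (p : ℝ≥0) < a → s p ≤ s a := by
    intro a p hap
    by_contra h
    obtain ⟨q, h1, _, h3⟩ := hlim a _ (gt_mem_nhds (not_le.1 h)) (a + 1) (by simp)
    exact absurd (hs p q (by exact_mod_cast hap.trans h1)) (not_lt.2 (le_of_lt h3))
  intro a b hab
  obtain ⟨q, hq1, hq2⟩ := exists_nnrat_between hab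
  obtain ⟨p, hp1, hp2⟩ := exists_nnrat_between hq1
  exact ((hle a p hp1).trans_lt (hs p q (by exact_mod_cast hp2))).trans_le (hge b q hq2)

/-! ### The Laplace exponent -/

section LaplaceExponent

variable {κ : ℝ} {ν : Measure ℝ}

lemma one_sub_exp_nonneg {l z : ℝ} (hl : 0 < l) (hz : 0 < z) : 0 ≤ 1 - Real.exp (-l * z) :=
  sub_nonneg.2 (Real.exp_le_one_iff.2 (by nlinarith))

lemma IsLevyMeasure.integrableOn (hν : IsLevyMeasure ν) {l : ℝ} (hl : 0 < l) :
    IntegrableOn (fun z => 1 - Real.exp (-l * z)) (Ioi 0) ν := by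
  have h1 : IntegrableOn (fun z : ℝ => min 1 z) (Ioi 0) ν := by
    refine ⟨Continuous.aestronglyMeasurable (by fun_prop), ?_⟩
    rw [hasFiniteIntegral_iff_ofReal]
    · exact hν.lintegral_lt_top
    · exact (ae_restrict_iff' measurableSet_Ioi).2
        (ae_of_all _ fun z hz => le_min zero_le_one (le_of_lt hz))
  -- The domination is `1 - e^{-lz} ≤ max(1, l) · min(1, z)`.
  refine Integrable.mono' (h1.const_mul (max 1 l)) (Continuous.aestronglyMeasurable (by fun_prop))
    ((ae_restrict_iff' measurableSet_Ioi).2 (ae_of_all _ fun z hz => ?_))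
  have hz' : 0 < z := hz
  rw [Real.norm_eq_abs, abs_of_nonneg (one_sub_exp_nonneg hl hz')]
  have e1 := Real.exp_pos (-l * z)
  have e2 := Real.add_one_le_exp (-l * z)
  rcases min_cases 1 z with ⟨h, _⟩ | ⟨h, _⟩ <;> rw [h]
  · linarith [le_max_left 1 l]
  · have := mul_le_mul_of_nonneg_right (le_max_right 1 l) hz'.le
    linarith

lemma laplaceExponent_pos (hκ : 0 ≤ κ) (hν : IsLevyMeasure ν)
    (hstrict : 0 < κ ∨ ν (Ioi 0) = ∞) {l : ℝ} (hl : 0 < l) : 0 < laplaceExponent κ ν l := by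
  have hnn : 0 ≤ᵐ[ν.restrict (Ioi 0)] fun z => 1 - Real.exp (-l * z) :=
    (ae_restrict_iff' measurableSet_Ioi).2 (ae_of_all _ fun z hz => one_sub_exp_nonneg hl hz)
  have h0 : 0 ≤ ∫ z in Ioi (0 : ℝ), (1 - Real.exp (-l * z)) ∂ν := integral_nonneg_of_ae hnn
  unfold laplaceExponent
  rcases hstrict with h | h
  · have := mul_pos h hl
    linarith
  · have : 0 < ∫ z in Ioi (0 : ℝ), (1 - Real.exp (-l * z)) ∂ν := by
      rw [setIntegral_pos_iff_support_of_nonneg_ae hnn (hν.integrableOn hl)]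
      have : Function.support (fun z => 1 - Real.exp (-l * z)) ∩ Ioi 0 = Ioi 0 := by
        refine inter_eq_right.2 fun z hz => ?_
        have hz' : 0 < z := hz
        have : Real.exp (-l * z) < 1 := Real.exp_lt_one_iff.2 (by nlinarith)
        exact (sub_pos.2 this).ne'
      rw [this, h]
      exact ENNReal.zero_lt_top
    have := mul_nonneg hκ hl.le
    linarith

/-- The Laplace exponent of a strictly increasing subordinator is unbounded. -/
lemma exists_laplaceExponent_ge (hκ : 0 ≤ κ) (hν : IsLevyMeasure ν)
    (hstrict : 0 < κ ∨ ν (Ioi 0) = ∞) (M : ℝ) : ∃ l, 0 < l ∧ M ≤ laplaceExponent κ ν l := by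
  have hnn : ∀ l, 0 < l → 0 ≤ᵐ[ν.restrict (Ioi 0)] fun z => 1 - Real.exp (-l * z) := fun l hl =>
    (ae_restrict_iff' measurableSet_Ioi).2 (ae_of_all _ fun z hz => one_sub_exp_nonneg hl hz)
  rcases hstrict with h | h
  · refine ⟨(|M| + 1) / κ, by positivity, ?_⟩
    have h0 : 0 ≤ ∫ z in Ioi (0 : ℝ), (1 - Real.exp (-((|M| + 1) / κ) * z)) ∂ν :=
      integral_nonneg_of_ae (hnn _ (by positivity))
    have : κ * ((|M| + 1) / κ) = |M| + 1 := by field_simp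
    unfold laplaceExponent
    rw [this]
    linarith [le_abs_self M]
  -- As `n` grows, `1 - e^{-(n+1)z}` increases to `1`, so by monotone convergence the integrals tend
  -- to the infinite mass of `ν`.
  · have ht : Tendsto (fun n : ℕ => ∫⁻ z in Ioi (0 : ℝ),
        ENNReal.ofReal (1 - Real.exp (-(n + 1 : ℝ) * z)) ∂ν) atTop
        (𝓝 (∫⁻ z in Ioi (0 : ℝ), 1 ∂ν)) := by
      refine lintegral_tendsto_of_tendsto_of_monotone
        (fun n => Measurable.aemeasurable (by fun_prop))
        ((ae_restrict_iff' measurableSet_Ioi).2 (ae_of_all _ fun z hz m n hmn => ?_))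
        ((ae_restrict_iff' measurableSet_Ioi).2 (ae_of_all _ fun z hz => ?_))
      · refine ENNReal.ofReal_le_ofReal (sub_le_sub_left (Real.exp_le_exp.2 ?_) 1)
        have : (m : ℝ) ≤ n := by exact_mod_cast hmn
        have hz' : 0 < z := hz
        nlinarith
      · have hz' : 0 < z := hz
        rw [← ENNReal.ofReal_one]
        refine ENNReal.tendsto_ofReal ?_
        have h1 : Tendsto (fun n : ℕ => (n + 1 : ℝ) * z) atTop atTop :=
          (tendsto_natCast_atTop_atTop.atTop_add tendsto_const_nhds).atTop_mul_const hz'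
        have h2 := (Real.tendsto_exp_neg_atTop_nhds_zero.comp h1).const_sub 1
        simp only [sub_zero] at h2
        refine h2.congr fun n => ?_
        simp only [Function.comp, neg_mul]
    rw [lintegral_one, Measure.restrict_apply_univ, h] at ht
    obtain ⟨n, hn⟩ := (ht.eventually (lt_mem_nhds (ENNReal.ofReal_lt_top (r := M)))).exists
    have hl : (0 : ℝ) < n + 1 := by positivity
    refine ⟨n + 1, hl, ?_⟩
    rw [← ofReal_integral_eq_lintegral_ofReal (hν.integrableOn hl) (hnn _ hl)] at hn
    have : M < ∫ z in Ioi (0 : ℝ), (1 - Real.exp (-(n + 1 : ℝ) * z)) ∂ν :=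
      lt_of_not_ge fun hc => absurd hn (not_lt.2 (ENNReal.ofReal_le_ofReal hc))
    have h3 := mul_nonneg hκ hl.le
    unfold laplaceExponent
    linarith

end LaplaceExponent

/-! ### Almost sure path properties of the subordinator -/

section Subordinator

variable {Ω : Type*} [MeasurableSpace Ω] {P : Measure Ω} [IsProbabilityMeasure P] {κ : ℝ}
  {ν : Measure ℝ} {S : ℝ≥0 → Ω → ℝ}

lemma IsSubordinator.integrable_exp (hS : IsSubordinator κ ν S P) {l : ℝ} (hl : 0 < l) (t : ℝ≥0) :
    Integrable (fun ω => Real.exp (-l * S t ω)) P := by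
  have := hS.measurable t
  refine (integrable_const (1 : ℝ)).mono' (Measurable.aestronglyMeasurable (by fun_prop)) ?_
  filter_upwards [hS.nonneg] with ω hω
  rw [Real.norm_eq_abs, Real.abs_exp]
  exact Real.exp_le_one_iff.2 (by nlinarith [hω t])

/-- Markov's inequality for `e^{-l S_t}`. Taking `M = 0` and `φ(l)` large gives strict positivity;
taking `l = 1` and `t → ∞` gives unbounded paths. -/
lemma IsSubordinator.exp_mul_measureReal_le (hS : IsSubordinator κ ν S P) {l : ℝ} (hl : 0 < l)
    (t : ℝ≥0) (M : ℝ) :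
    Real.exp (-l * M) * P.real {ω | S t ω ≤ M} ≤ Real.exp (-(t : ℝ) * laplaceExponent κ ν l) := by
  rw [← hS.laplace t l hl]
  refine le_trans ?_ (mul_meas_ge_le_integral_of_nonneg
    (ae_of_all _ fun ω => (Real.exp_pos _).le) (hS.integrable_exp hl t) (Real.exp (-l * M)))
  refine mul_le_mul_of_nonneg_left (measureReal_mono fun ω hω => ?_) (Real.exp_pos _).le
  have : S t ω ≤ M := hω
  exact Real.exp_le_exp.2 (by nlinarith)

lemma IsSubordinator.ae_pos (hκ : 0 ≤ κ) (hν : IsLevyMeasure ν)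
    (hstrict : 0 < κ ∨ ν (Ioi 0) = ∞) (hS : IsSubordinator κ ν S P) {t : ℝ≥0} (ht : 0 < t) :
    ∀ᵐ ω ∂P, 0 < S t ω := by
  have h0 : P.real {ω | S t ω ≤ 0} = 0 := by
    refine le_antisymm (le_of_forall_pos_le_add fun ε hε => ?_) measureReal_nonneg
    obtain ⟨l, hl, hM⟩ := exists_laplaceExponent_ge hκ hν hstrict (-Real.log ε / t)
    have h1 := hS.exp_mul_measureReal_le hl t 0
    rw [mul_zero, Real.exp_zero, one_mul] at h1
    refine h1.trans ?_
    rw [zero_add]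
    have ht' : (0 : ℝ) < t := ht
    calc Real.exp (-(t : ℝ) * laplaceExponent κ ν l) ≤ Real.exp (Real.log ε) := by
          refine Real.exp_le_exp.2 ?_
          rw [div_le_iff₀ ht'] at hM
          linarith
      _ = ε := Real.exp_log hε
  rw [measureReal_eq_zero_iff] at h0
  simpa [ae_iff] using h0

lemma IsSubordinator.ae_strictMono_rat (hκ : 0 ≤ κ) (hν : IsLevyMeasure ν)
    (hstrict : 0 < κ ∨ ν (Ioi 0) = ∞) (hS : IsSubordinator κ ν S P) :
    ∀ᵐ ω ∂P, ∀ p q : ℚ≥0, p < q → S (p : ℝ≥0) ω < S (q : ℝ≥0) ω := by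
  rw [ae_all_iff]
  intro p
  rw [ae_all_iff]
  intro q
  by_cases hpq : p < q
  · have hpq' : (p : ℝ≥0) < q := by exact_mod_cast hpq
    have hd := hS.stationaryIncrements p (q - p)
    have h1 := hS.ae_pos hκ hν hstrict (tsub_pos_of_lt hpq')
    have h2 : ∀ᵐ ω ∂P, 0 < S ((p : ℝ≥0) + (q - p)) ω - S p ω :=
      hd.symm.ae_snd (p := fun x => 0 < x) measurableSet_Ioi h1
    rw [add_tsub_cancel_of_le hpq'.le] at h2
    filter_upwards [h2] with ω hω _
    linarith
  · exact ae_of_all _ fun ω h => absurd h hpq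

lemma IsSubordinator.ae_unbounded (hκ : 0 ≤ κ) (hν : IsLevyMeasure ν)
    (hstrict : 0 < κ ∨ ν (Ioi 0) = ∞) (hS : IsSubordinator κ ν S P) :
    ∀ᵐ ω ∂P, ∀ M : ℝ, ∃ r, M < S r ω := by
  have h : ∀ M : ℕ, ∀ᵐ ω ∂P, ∃ n : ℕ, (M : ℝ) < S n ω := by
    intro M
    have h0 : P.real {ω | ∀ n : ℕ, S n ω ≤ M} = 0 := by
      have hlim : Tendsto (fun n : ℕ => Real.exp M *
          Real.exp (-(n : ℝ) * laplaceExponent κ ν 1)) atTop (𝓝 (Real.exp M * 0)) := by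
        refine Tendsto.const_mul _ ?_
        have := Real.tendsto_exp_neg_atTop_nhds_zero.comp
          (tendsto_natCast_atTop_atTop.atTop_mul_const
            (laplaceExponent_pos hκ hν hstrict one_pos))
        refine this.congr fun n => ?_
        simp only [Function.comp, neg_mul]
      rw [mul_zero] at hlim
      refine le_antisymm (ge_of_tendsto' hlim fun n => ?_) measureReal_nonneg
      have h1 := hS.exp_mul_measureReal_le one_pos n M
      have h2 : P.real {ω | ∀ n : ℕ, S n ω ≤ M} ≤ P.real {ω | S n ω ≤ M} :=
        measureReal_mono fun ω hω => hω n
      have h3 : Real.exp M * (Real.exp (-1 * M) * P.real {ω | S n ω ≤ M}) =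
          P.real {ω | S n ω ≤ M} := by
        rw [← mul_assoc, ← Real.exp_add]
        simp
      rw [NNReal.coe_natCast] at h1
      have := mul_le_mul_of_nonneg_left h1 (Real.exp_pos (M : ℝ)).le
      linarith
    rw [measureReal_eq_zero_iff] at h0
    simpa [ae_iff] using h0
  filter_upwards [ae_all_iff.2 h] with ω hω M
  obtain ⟨m, hm⟩ := exists_nat_gt M
  obtain ⟨n, hn⟩ := hω m
  exact ⟨n, hm.trans hn⟩

lemma IsSubordinator.ae_isGoodPath (hκ : 0 ≤ κ) (hν : IsLevyMeasure ν)
    (hstrict : 0 < κ ∨ ν (Ioi 0) = ∞) (hS : IsSubordinator κ ν S P) :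
    ∀ᵐ ω ∂P, IsGoodPath fun r => S r ω := by
  filter_upwards [hS.ae_strictMono_rat hκ hν hstrict, hS.ae_unbounded hκ hν hstrict, hS.zero,
    hS.cadlag] with ω h1 h2 h3 h4
  exact ⟨strictMono_of_strictMono_rat h1 fun t => (h4 t).1, fun t => (h4 t).1, h3, h2⟩

/-! ### The inverse subordinator at an independent exponential time -/

lemma measurable_path (hm : ∀ r, Measurable (S r)) : Measurable fun ω r => S r ω :=
  measurable_pi_lambda _ hm

lemma measurable_ratPathInv_prod (hm : ∀ r, Measurable (S r)) :
    Measurable fun p : Ω × ℝ => ratPathInv p.2 fun r => S r p.1 :=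
  measurable_ratPathInv.comp (measurable_snd.prodMk ((measurable_path hm).comp measurable_fst))

lemma ae_inverseSubordinator_eq {P : Measure Ω} (hg : ∀ᵐ ω ∂P, IsGoodPath fun r => S r ω) :
    ∀ᵐ ω ∂P, ∀ t, inverseSubordinator S t ω = ratPathInv t fun r => S r ω := by
  filter_upwards [hg] with ω hω t
  exact (hω.ratPathInv_eq t).symm

/-- At an independent exponential time of rate `l`, the inverse subordinator is exponential of
rate `φ(l)`. -/
lemma IsSubordinator.map_ratPathInv (hS : IsSubordinator κ ν S P)
    (hg : ∀ᵐ ω ∂P, IsGoodPath fun r => S r ω) {l : ℝ} (hl : 0 < l)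
    (hφ : 0 < laplaceExponent κ ν l) :
    (P.prod (expMeasure l)).map (fun p => ((ratPathInv p.2 fun r => S r p.1 : ℝ≥0) : ℝ)) =
      expMeasure (laplaceExponent κ ν l) := by
  have := isProbabilityMeasure_expMeasure hl
  have := isProbabilityMeasure_expMeasure hφ
  have hm : Measurable fun p : Ω × ℝ => ((ratPathInv p.2 fun r => S r p.1 : ℝ≥0) : ℝ) :=
    (measurable_ratPathInv_prod hS.measurable).coe_nnreal_real
  have := Measure.isProbabilityMeasure_map (μ := P.prod (expMeasure l)) hm.aemeasurable
  suffices h : ∀ x : ℝ, (P.prod (expMeasure l)).map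
      (fun p => ((ratPathInv p.2 fun r => S r p.1 : ℝ≥0) : ℝ)) (Ioi x) =
      expMeasure (laplaceExponent κ ν l) (Ioi x) by
    refine Measure.ext_of_Iic _ _ fun x => ?_
    rw [← compl_Ioi, prob_compl_eq_one_sub measurableSet_Ioi,
      prob_compl_eq_one_sub measurableSet_Ioi, h]
  intro x
  rw [Measure.map_apply hm measurableSet_Ioi]
  rcases lt_or_ge x 0 with hx | hx
  · have h1 : (fun p : Ω × ℝ => ((ratPathInv p.2 fun r => S r p.1 : ℝ≥0) : ℝ)) ⁻¹' Ioi x =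
        univ := by
      ext p
      simpa using hx.trans_le (NNReal.coe_nonneg _)
    rw [h1, measure_univ]
    refine ((prob_compl_eq_zero_iff measurableSet_Ioi).1 ?_).symm
    rw [compl_Ioi]
    exact measure_mono_null (fun y hy => lt_of_le_of_lt hy hx) (expMeasure_Iio_zero _)
  · lift x to ℝ≥0 using hx
    rw [Measure.prod_apply (hm measurableSet_Ioi), expMeasure_Ioi hφ x.coe_nonneg]
    -- For a fixed path, `{t | x < L_t}` is the half-line beyond `S_x`, up to the null point `S_x`.
    -- Averaging its exponential tail over `ω` produces the Laplace transform of `S_x`.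
    have h1 : ∀ᵐ ω ∂P, expMeasure l (Prod.mk ω ⁻¹'
        ((fun p : Ω × ℝ => ((ratPathInv p.2 fun r => S r p.1 : ℝ≥0) : ℝ)) ⁻¹' Ioi (x : ℝ))) =
        ENNReal.ofReal (Real.exp (-l * S x ω)) := by
      filter_upwards [hg] with ω hω
      have h0 : 0 ≤ S x ω := by
        rw [← hω.zero]
        exact hω.strictMono.monotone bot_le
      rw [neg_mul, ← expMeasure_Ioi hl h0]
      have hset : Prod.mk ω ⁻¹' ((fun p : Ω × ℝ =>
          ((ratPathInv p.2 fun r => S r p.1 : ℝ≥0) : ℝ)) ⁻¹' Ioi (x : ℝ)) =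
          {t | x < pathInv (fun r => S r ω) t} := by
        ext t
        simp [hω.ratPathInv_eq]
      rw [hset]
      have hnull : expMeasure l {S x ω} = 0 := by
        have : expMeasure l = volume.withDensity (exponentialPDF l) := rfl
        rw [this]
        exact withDensity_absolutelyContinuous _ _ Real.volume_singleton
      refine le_antisymm ?_ (measure_mono fun t ht => hω.lt_pathInv_of_lt ht)
      calc expMeasure l {t | x < pathInv (fun r => S r ω) t}
          ≤ expMeasure l ({S x ω} ∪ Ioi (S x ω)) := by
            refine measure_mono fun t ht => ?_
            rcases (le_of_lt_pathInv ht).eq_or_lt with h | h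
            · exact Or.inl h.symm
            · exact Or.inr h
        _ ≤ expMeasure l {S x ω} + expMeasure l (Ioi (S x ω)) := measure_union_le _ _
        _ = _ := by rw [hnull, zero_add]
    rw [lintegral_congr_ae h1, ← ofReal_integral_eq_lintegral_ofReal (hS.integrable_exp hl x)
      (ae_of_all _ fun ω => (Real.exp_pos _).le), hS.laplace x l hl]
    ring_nf

end Subordinator

/-! ### Brownian motion at an independent random time -/

section RandomTime

/-- A countable dense family of times. -/
def gridPoint (i : ℕ × ℕ) : ℝ≥0 := (i.2 : ℝ≥0) / (i.1 + 1)

lemma tendsto_gridPoint (r : ℝ≥0) :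
    Tendsto (fun n : ℕ => gridPoint (n, ⌊(r : ℝ) * (n + 1)⌋₊)) atTop (𝓝 r) := by
  rw [← NNReal.tendsto_coe]
  have h : Tendsto (fun x : ℝ => (⌊(r : ℝ) * x⌋₊ : ℝ) / x) atTop (𝓝 (r : ℝ)) :=
    tendsto_nat_floor_mul_div_atTop r.coe_nonneg
  have h1 : Tendsto (fun n : ℕ => (n + 1 : ℝ)) atTop atTop :=
    tendsto_natCast_atTop_atTop.atTop_add tendsto_const_nhds
  refine (h.comp h1).congr fun n => ?_
  simp only [Function.comp, gridPoint]
  push_cast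
  rfl

/-- The evaluation at `r` of the continuous path with values `w` on the grid. -/
def gridEval (p : ℝ≥0 × (ℕ × ℕ → ℝ)) : ℝ :=
  limsup (fun n : ℕ => p.2 (n, ⌊(p.1 : ℝ) * (n + 1)⌋₊)) atTop

/-- A `limsup` makes the evaluation measurable on all grid data; on continuous paths it is a limit.
-/
lemma measurable_gridEval : Measurable gridEval := by
  refine Measurable.limsup fun n => ?_
  have h1 : Measurable fun q : ℕ × (ℕ × ℕ → ℝ) => q.2 (n, q.1) :=
    measurable_from_prod_countable_right fun k => measurable_pi_apply (n, k)
  have h2 : Measurable fun p : ℝ≥0 × (ℕ × ℕ → ℝ) => ⌊(p.1 : ℝ) * (n + 1)⌋₊ :=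
    Nat.measurable_floor.comp (measurable_fst.coe_nnreal_real.mul_const _)
  exact h1.comp (h2.prodMk measurable_snd)

lemma gridEval_eq {b : ℝ≥0 → ℝ} (hb : Continuous b) (r : ℝ≥0) :
    gridEval (r, fun i => b (gridPoint i)) = b r :=
  ((hb.tendsto r).comp (tendsto_gridPoint r)).limsup_eq

variable {Ω : Type*} [MeasurableSpace Ω] {P : Measure Ω} [IsProbabilityMeasure P]
  {B : ℝ≥0 → Ω → ℝ} {T : Ω → ℝ≥0}

/-- If `T` is independent of the Brownian motion `B`, then `(T, B_T)` has the law of `(T, √T Z)`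
with `Z` standard normal and independent of `T`. -/
lemma map_prodMk_brownian_eq (hB : IsBrownianReal B P) (hT : Measurable T)
    (hTB : IndepFun T (fun ω r => B r ω) P) :
    AEMeasurable (fun ω => (T ω, B (T ω) ω)) P ∧
      P.map (fun ω => (T ω, B (T ω) ω)) =
        ((P.map T).prod (gaussianReal 0 1)).map fun p : ℝ≥0 × ℝ => (p.1, √(p.1 : ℝ) * p.2) := by
  -- Each `B r` is used only as an a.e. measurable map and continuity holds only almost surely.
  -- Countably many grid times can be replaced by measurable versions at once, and `gridEval`
  -- recovers `B_T` from them.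
  set W : Ω → ℕ × ℕ → ℝ := fun ω i => (hB.aemeasurable (gridPoint i)).mk _ ω with hW
  have hWm : Measurable W := measurable_pi_lambda _ fun i => (hB.aemeasurable _).measurable_mk
  have hWae : ∀ᵐ ω ∂P, (fun i => B (gridPoint i) ω) = W ω := by
    have : ∀ᵐ ω ∂P, ∀ i, B (gridPoint i) ω = W ω i :=
      ae_all_iff.2 fun i => (hB.aemeasurable _).ae_eq_mk
    filter_upwards [this] with ω hω using funext hω
  have hev : ∀ᵐ ω ∂P, ∀ r, gridEval (r, W ω) = B r ω := by
    filter_upwards [hWae, hB.cont] with ω h1 h2 r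
    rw [← h1]
    exact gridEval_eq h2 r
  have hind : IndepFun T W P := by
    have h1 : IndepFun T (fun ω i => B (gridPoint i) ω) P :=
      hTB.comp (φ := id) (ψ := fun (b : ℝ≥0 → ℝ) (i : ℕ × ℕ) => b (gridPoint i)) measurable_id
        (measurable_pi_lambda _ fun i => measurable_pi_apply _)
    exact h1.congr (ae_eq_refl _) hWae
  have hpair : P.map (fun ω => (T ω, W ω)) = (P.map T).prod (P.map W) :=
    (indepFun_iff_map_prod_eq_prod_map_map hT.aemeasurable hWm.aemeasurable).1 hind
  have hTev : Measurable fun p : ℝ≥0 × (ℕ × ℕ → ℝ) => (p.1, gridEval p) :=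
    measurable_fst.prodMk measurable_gridEval
  have hae : (fun ω => (T ω, B (T ω) ω)) =ᵐ[P] fun ω => (T ω, gridEval (T ω, W ω)) := by
    filter_upwards [hev] with ω hω
    rw [hω]
  have hm : Measurable fun ω => (T ω, gridEval (T ω, W ω)) :=
    hTev.comp (hT.prodMk hWm)
  have := Measure.isProbabilityMeasure_map (μ := P) hT.aemeasurable
  have := Measure.isProbabilityMeasure_map (μ := P) hWm.aemeasurable
  have hsm : Measurable fun p : ℝ≥0 × ℝ => (p.1, √(p.1 : ℝ) * p.2) := by fun_prop
  refine ⟨hm.aemeasurable.congr hae.symm, ?_⟩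
  have e1 : P.map (fun ω => (T ω, B (T ω) ω)) =
      ((P.map T).prod (P.map W)).map fun p => (p.1, gridEval p) := by
    rw [Measure.map_congr hae, ← hpair, Measure.map_map hTev (hT.prodMk hWm)]
    rfl
  rw [e1]
  -- At a deterministic time both sides are centred Gaussian of variance `r`; independence lets this
  -- be integrated over the law of `T`.
  have hlaw : ∀ r : ℝ≥0, (P.map W).map (fun w => gridEval (r, w)) =
      (gaussianReal 0 1).map (fun z => √(r : ℝ) * z) := by
    intro r
    have h1 : Measurable fun w => gridEval (r, w) :=
      measurable_gridEval.comp measurable_prodMk_left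
    rw [Measure.map_map h1 hWm, gaussianReal_map_const_mul]
    have h2 : P.map (fun ω => gridEval (r, W ω)) = P.map (B r) :=
      Measure.map_congr (hev.mono fun ω hω => hω r)
    change P.map (fun ω => gridEval (r, W ω)) = _
    rw [h2, (hB.hasLaw_eval r).map_eq]
    congr 1
    · simp
    · ext
      simp
  ext A hA
  rw [Measure.map_apply hTev hA, Measure.map_apply hsm hA, Measure.prod_apply (hTev hA),
    Measure.prod_apply (hsm hA)]
  refine lintegral_congr fun r => ?_
  have h1 : Measurable fun w => gridEval (r, w) := measurable_gridEval.comp measurable_prodMk_left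
  have h2 : Measurable fun z => √(r : ℝ) * z := by fun_prop
  have hA' : MeasurableSet (Prod.mk r ⁻¹' A) := measurable_prodMk_left hA
  have := congrArg (fun m => m (Prod.mk r ⁻¹' A)) (hlaw r)
  simp only [Measure.map_apply h1 hA', Measure.map_apply h2 hA'] at this
  exact this

end RandomTime

/-! ### The call value along the inverse subordinator -/

lemma measurable_bsValue (σ K x : ℝ) : Measurable fun r => bsValue σ K r x := by
  have : Continuous fun p : ℝ × ℝ => callPayoff K (x * bsFactor σ p.1 p.2) :=
    (continuous_callPayoff K).comp (continuous_const.mul (continuous_bsFactor σ))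
  exact (this.stronglyMeasurable.integral_prod_right (ν := gaussianReal 0 1)).measurable

lemma integrable_callPayoff_bsFactor_prod {μ : Measure ℝ≥0} [IsProbabilityMeasure μ]
    {σ K x : ℝ} (hK : 0 ≤ K) (hx : 0 ≤ x) :
    Integrable (fun p : ℝ≥0 × ℝ => callPayoff K (x * bsFactor σ p.1 p.2))
      (μ.prod (gaussianReal 0 1)) := by
  have hc : Continuous fun p : ℝ≥0 × ℝ => bsFactor σ p.1 p.2 :=
    (continuous_bsFactor σ).comp
      ((NNReal.continuous_coe.comp continuous_fst).prodMk continuous_snd)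
  have h1 : Integrable (fun p : ℝ≥0 × ℝ => bsFactor σ p.1 p.2) (μ.prod (gaussianReal 0 1)) := by
    rw [integrable_prod_iff hc.aestronglyMeasurable]
    refine ⟨ae_of_all _ fun r => integrable_bsFactor σ r, ?_⟩
    refine (integrable_const (1 : ℝ)).congr (ae_of_all _ fun r => ?_)
    simp only [Real.norm_eq_abs, abs_of_pos (bsFactor_pos _ _ _)]
    exact (integral_bsFactor σ r.coe_nonneg).symm
  refine (h1.const_mul x).mono' ?_ (ae_of_all _ fun p => ?_)
  · exact ((continuous_callPayoff K).comp (continuous_const.mul hc)).aestronglyMeasurable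
  · rw [Real.norm_eq_abs, abs_of_nonneg (callPayoff_nonneg _ _)]
    exact callPayoff_le hK (mul_nonneg hx (bsFactor_pos _ _ _).le)

section CallValue

variable {Ω : Type*} [MeasurableSpace Ω] {P : Measure Ω} [IsProbabilityMeasure P]
  {S B : ℝ≥0 → Ω → ℝ} {σ K : ℝ}

/-- Conditionally on `L_t = r`, the variable `B_{L_t}` is distributed as `√r Z`, so the conditional
expectation of the payoff is the Black–Scholes value at time `r`. -/
lemma integrable_callPayoff_and_callValue_eq (hSm : ∀ r, Measurable (S r))
    (hg : ∀ᵐ ω ∂P, IsGoodPath fun r => S r ω) (hB : IsBrownianReal B P)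
    (hSB : IndepFun (fun ω r => S r ω) (fun ω r => B r ω) P) (hK : 0 ≤ K) (t : ℝ) {x : ℝ}
    (hx : 0 ≤ x) :
    Integrable (fun ω => callPayoff K (geometricBM σ B x (inverseSubordinator S t ω) ω)) P ∧
      callValue P S B σ K t x = ∫ ω, bsValue σ K (ratPathInv t fun r => S r ω) x ∂P := by
  set T : Ω → ℝ≥0 := fun ω => ratPathInv t fun r => S r ω with hT
  have hrat : Measurable (ratPathInv t) := measurable_ratPathInv.comp measurable_prodMk_left
  have hTm : Measurable T := hrat.comp (measurable_path hSm)
  have hTB : IndepFun T (fun ω r => B r ω) P := hSB.comp hrat measurable_id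
  obtain ⟨hae, hmap⟩ := map_prodMk_brownian_eq hB hTm hTB
  have := Measure.isProbabilityMeasure_map (μ := P) hTm.aemeasurable
  set F : ℝ≥0 × ℝ → ℝ := fun p => callPayoff K (x * Real.exp (σ * p.2 - σ ^ 2 / 2 * (p.1 : ℝ)))
    with hF
  have hFc : Continuous F := (continuous_callPayoff K).comp (by fun_prop)
  have hsm : Measurable fun p : ℝ≥0 × ℝ => (p.1, √(p.1 : ℝ) * p.2) := by fun_prop
  have hcongr : (fun ω => F (T ω, B (T ω) ω)) =ᵐ[P]
      fun ω => callPayoff K (geometricBM σ B x (inverseSubordinator S t ω) ω) := by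
    filter_upwards [ae_inverseSubordinator_eq hg] with ω hω
    rw [hω t]
    rfl
  have hint : Integrable F (P.map fun ω => (T ω, B (T ω) ω)) := by
    rw [hmap, integrable_map_measure hFc.aestronglyMeasurable hsm.aemeasurable]
    exact integrable_callPayoff_bsFactor_prod hK hx
  refine ⟨((integrable_map_measure hFc.aestronglyMeasurable hae).1 hint).congr hcongr, ?_⟩
  calc callValue P S B σ K t x = ∫ ω, F (T ω, B (T ω) ω) ∂P := (integral_congr_ae hcongr).symm
    _ = ∫ p, F p ∂(P.map fun ω => (T ω, B (T ω) ω)) :=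
      (integral_map hae hFc.aestronglyMeasurable).symm
    _ = ∫ p : ℝ≥0 × ℝ, callPayoff K (x * bsFactor σ p.1 p.2)
          ∂((P.map T).prod (gaussianReal 0 1)) := by
      rw [hmap, integral_map hsm.aemeasurable hFc.aestronglyMeasurable]
      rfl
    _ = ∫ r : ℝ≥0, bsValue σ K r x ∂(P.map T) := by
      rw [integral_prod _ (integrable_callPayoff_bsFactor_prod hK hx)]
      rfl
    _ = ∫ ω, bsValue σ K (T ω) x ∂P :=
      integral_map hTm.aemeasurable (continuous_bsValue hx).aestronglyMeasurable

lemma integrable_bsValue_comp (hK : 0 ≤ K) {x : ℝ} (hx : 0 ≤ x) {α : Type*} [MeasurableSpace α]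
    {μ : Measure α} [IsFiniteMeasure μ] {T : α → ℝ≥0} (hT : AEMeasurable T μ) :
    Integrable (fun a => bsValue σ K (T a) x) μ := by
  refine (integrable_const x).mono'
    ((measurable_bsValue σ K x).comp_aemeasurable hT.coe_nnreal_real).aestronglyMeasurable
    (ae_of_all _ fun a => ?_)
  rw [Real.norm_eq_abs, abs_of_nonneg (bsValue_nonneg _ _ _ _)]
  exact bsValue_le hK (NNReal.coe_nonneg _) hx

variable (hSm : ∀ r, Measurable (S r)) (hg : ∀ᵐ ω ∂P, IsGoodPath fun r => S r ω)
  (hB : IsBrownianReal B P) (hSB : IndepFun (fun ω r => S r ω) (fun ω r => B r ω) P) (hK : 0 ≤ K)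

include hSm hg hB hSB hK

lemma abs_callValue_le (t : ℝ) {x : ℝ} (hx : 0 ≤ x) : |callValue P S B σ K t x| ≤ x := by
  rw [(integrable_callPayoff_and_callValue_eq hSm hg hB hSB hK t hx).2]
  have := norm_integral_le_of_norm_le_const (μ := P) (C := x)
    (f := fun ω => bsValue σ K (ratPathInv t fun r => S r ω) x) (ae_of_all _ fun ω => by
      rw [Real.norm_eq_abs, abs_of_nonneg (bsValue_nonneg _ _ _ _)]
      exact bsValue_le hK (NNReal.coe_nonneg _) hx)
  simpa using this

lemma abs_callValue_sub_le (t : ℝ) {x y : ℝ} (hx : 0 ≤ x) (hy : 0 ≤ y) :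
    |callValue P S B σ K t x - callValue P S B σ K t y| ≤ |x - y| := by
  have hTm : Measurable fun ω => ratPathInv t fun r => S r ω :=
    (measurable_ratPathInv.comp measurable_prodMk_left).comp (measurable_path hSm)
  rw [(integrable_callPayoff_and_callValue_eq hSm hg hB hSB hK t hx).2,
    (integrable_callPayoff_and_callValue_eq hSm hg hB hSB hK t hy).2,
    ← integral_sub (integrable_bsValue_comp hK hx hTm.aemeasurable)
      (integrable_bsValue_comp hK hy hTm.aemeasurable)]
  have := norm_integral_le_of_norm_le_const (μ := P) (C := |x - y|)
    (f := fun ω => bsValue σ K (ratPathInv t fun r => S r ω) x -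
      bsValue σ K (ratPathInv t fun r => S r ω) y) (ae_of_all _ fun ω =>
      abs_bsValue_sub_le hK (NNReal.coe_nonneg _) hx hy)
  simpa using this

lemma continuous_callValue_time {x : ℝ} (hx : 0 ≤ x) :
    Continuous fun t => callValue P S B σ K t x := by
  simp only [(integrable_callPayoff_and_callValue_eq hSm hg hB hSB hK _ hx).2]
  refine continuous_of_dominated (bound := fun _ => x) (fun t => ?_)
    (fun t => ae_of_all _ fun ω => ?_) (integrable_const _) ?_
  · have hTm : Measurable fun ω => ratPathInv t fun r => S r ω :=
      (measurable_ratPathInv.comp measurable_prodMk_left).comp (measurable_path hSm)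
    exact (integrable_bsValue_comp hK hx hTm.aemeasurable).aestronglyMeasurable
  · rw [Real.norm_eq_abs, abs_of_nonneg (bsValue_nonneg _ _ _ _)]
    exact bsValue_le hK (NNReal.coe_nonneg _) hx
  · filter_upwards [hg] with ω hω
    simp only [hω.ratPathInv_eq]
    exact (continuous_bsValue hx).comp hω.continuous_pathInv

/-- Joint continuity follows from continuity in `t` together with a Lipschitz constant in `x` that
does not depend on `t`. -/
lemma continuousOn_callValue :
    ContinuousOn (fun p : ℝ × ℝ => callValue P S B σ K p.1 p.2) (Ici 0 ×ˢ Ioi 0) := by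
  refine continuousOn_prod_of_continuousOn_lipschitzOnWith'
    (fun p : ℝ × ℝ => callValue P S B σ K p.1 p.2) 1 (fun t _ => ?_) (fun x hx => ?_)
  · refine LipschitzOnWith.of_dist_le_mul fun x hx y hy => ?_
    rw [NNReal.coe_one, one_mul, Real.dist_eq, Real.dist_eq]
    exact abs_callValue_sub_le hSm hg hB hSB hK t (le_of_lt hx) (le_of_lt hy)
  · exact (continuous_callValue_time hSm hg hB hSB hK (le_of_lt hx)).continuousOn

lemma callValue_zero {x : ℝ} (hx : 0 ≤ x) : callValue P S B σ K 0 x = callPayoff K x := by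
  rw [(integrable_callPayoff_and_callValue_eq hSm hg hB hSB hK 0 hx).2]
  have : ∀ᵐ ω ∂P, bsValue σ K (ratPathInv 0 fun r => S r ω) x = callPayoff K x := by
    filter_upwards [hg] with ω hω
    rw [hω.ratPathInv_eq, hω.pathInv_zero, NNReal.coe_zero, bsValue_zero]
  rw [integral_congr_ae this]
  simp

lemma integrableOn_exp_mul_callValue {l x : ℝ} (hl : 0 < l) (hx : 0 ≤ x) :
    IntegrableOn (fun t => Real.exp (-l * t) * callValue P S B σ K t x) (Ioi 0) := by
  refine Integrable.mul_bdd (c := x) (integrableOn_exp_mul_Ioi (neg_lt_zero.2 hl) 0)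
    (continuous_callValue_time hSm hg hB hSB hK hx).aestronglyMeasurable (ae_of_all _ fun t => ?_)
  exact abs_callValue_le hSm hg hB hSB hK t hx

omit hSm in
-- Since `l e^{-lt} dt` is the exponential law, the transform is `l⁻¹` times the mean value at an
-- independent exponential time, where `L` is exponential of rate `φ(l)`.
lemma timeLaplace_callValue_eq {κ : ℝ} {ν : Measure ℝ} (hS : IsSubordinator κ ν S P) {l x : ℝ}
    (hl : 0 < l) (hφ : 0 < laplaceExponent κ ν l) (hx : 0 ≤ x) :
    timeLaplace (callValue P S B σ K) l x =
      l⁻¹ * ∫ r, bsValue σ K r x ∂(expMeasure (laplaceExponent κ ν l)) := by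
  have := isProbabilityMeasure_expMeasure hl
  have hm := measurable_ratPathInv_prod hS.measurable
  calc timeLaplace (callValue P S B σ K) l x
      = l⁻¹ * ∫ t, callValue P S B σ K t x ∂(expMeasure l) := by
        rw [integral_expMeasure hl, ← integral_const_mul]
        refine integral_congr_ae (ae_of_all _ fun t => ?_)
        simp only [smul_eq_mul, neg_mul]
        field_simp
    _ = l⁻¹ * ∫ t, (∫ ω, bsValue σ K (ratPathInv t fun r => S r ω) x ∂P) ∂(expMeasure l) := by
        simp only [(integrable_callPayoff_and_callValue_eq hS.measurable hg hB hSB hK _ hx).2]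
    _ = l⁻¹ * ∫ p : Ω × ℝ, bsValue σ K (ratPathInv p.2 fun r => S r p.1) x
          ∂(P.prod (expMeasure l)) := by
        rw [integral_prod_symm _ (integrable_bsValue_comp hK hx hm.aemeasurable)]
    _ = _ := by
        rw [← hS.map_ratPathInv hg hl hφ, integral_map hm.coe_nnreal_real.aemeasurable
          (measurable_bsValue σ K x).aestronglyMeasurable]

omit hSm in
lemma continuousOn_timeLaplace_callValue {κ : ℝ} {ν : Measure ℝ} (hS : IsSubordinator κ ν S P)
    {l : ℝ} (hl : 0 < l) (hφ : 0 < laplaceExponent κ ν l) :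
    ContinuousOn (timeLaplace (callValue P S B σ K) l) (Ioi 0) := by
  have := isProbabilityMeasure_expMeasure hφ
  have hi : ∀ x, 0 ≤ x →
      Integrable (fun r => bsValue σ K r x) (expMeasure (laplaceExponent κ ν l)) := by
    intro x hx
    refine (integrable_const x).mono' (measurable_bsValue σ K x).aestronglyMeasurable ?_
    filter_upwards [ae_nonneg_expMeasure _] with r hr
    rw [Real.norm_eq_abs, abs_of_nonneg (bsValue_nonneg _ _ _ _)]
    exact bsValue_le hK hr hx
  have hL : LipschitzOnWith (Real.toNNReal l⁻¹) (timeLaplace (callValue P S B σ K) l) (Ioi 0) := by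
    refine LipschitzOnWith.of_dist_le_mul fun x hx y hy => ?_
    have hx' : 0 ≤ x := le_of_lt hx
    have hy' : 0 ≤ y := le_of_lt hy
    have hl' : 0 ≤ l⁻¹ := inv_nonneg.2 hl.le
    rw [Real.coe_toNNReal _ hl', Real.dist_eq, Real.dist_eq,
      timeLaplace_callValue_eq hg hB hSB hK hS hl hφ hx',
      timeLaplace_callValue_eq hg hB hSB hK hS hl hφ hy', ← mul_sub, abs_mul, abs_of_nonneg hl',
      ← integral_sub (hi x hx') (hi y hy')]
    refine mul_le_mul_of_nonneg_left ?_ hl'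
    have := norm_integral_le_of_norm_le_const (μ := expMeasure (laplaceExponent κ ν l))
      (C := |x - y|) (f := fun r => bsValue σ K r x - bsValue σ K r y) (by
        filter_upwards [ae_nonneg_expMeasure _] with r hr
        exact abs_bsValue_sub_le hK hr hx' hy')
    simpa using this
  exact hL.continuousOn

omit hSm in
lemma isLaplaceSolution_callValue {κ : ℝ} {ν : Measure ℝ} (hS : IsSubordinator κ ν S P)
    (hφ : ∀ l, 0 < l → 0 < laplaceExponent κ ν l) :
    IsLaplaceSolution κ ν σ (callPayoff K) (callValue P S B σ K) := by
  refine ⟨0, le_rfl, fun l hl => ⟨fun x hx =>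
    integrableOn_exp_mul_callValue hS.measurable hg hB hSB hK hl hx.le, ⟨l⁻¹, fun x hx => ?_⟩, ?_⟩⟩
  · have := isProbabilityMeasure_expMeasure (hφ l hl)
    have hl' : 0 ≤ l⁻¹ := inv_nonneg.2 hl.le
    rw [timeLaplace_callValue_eq hg hB hSB hK hS hl (hφ l hl) hx.le, abs_mul, abs_of_nonneg hl']
    refine mul_le_mul_of_nonneg_left ?_ hl'
    have := norm_integral_le_of_norm_le_const (μ := expMeasure (laplaceExponent κ ν l))
      (C := x) (f := fun r => bsValue σ K r x) (by
        filter_upwards [ae_nonneg_expMeasure _] with r hr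
        rw [Real.norm_eq_abs, abs_of_nonneg (bsValue_nonneg _ _ _ _)]
        exact bsValue_le hK hr hx.le)
    rw [Real.norm_eq_abs] at this
    refine this.trans ?_
    simp
  · have := isProbabilityMeasure_bsExpLaw σ (hφ l hl)
    have hc := continuousOn_timeLaplace_callValue (σ := σ) hg hB hSB hK hS hl (hφ l hl)
    have heq : EqOn (timeLaplace (callValue P S B σ K) l)
        (fun x => l⁻¹ * ∫ z, callPayoff K (x * Real.exp z)
          ∂(bsExpLaw σ (laplaceExponent κ ν l))) (Ioi 0) := by
      intro x hx
      rw [timeLaplace_callValue_eq hg hB hSB hK hS hl (hφ l hl) (le_of_lt hx),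
        integral_bsValue_expMeasure hK (hφ l hl) (le_of_lt hx)]
    have hloc := (hc.congr heq.symm).locallyIntegrableOn (μ := volume) measurableSet_Ioi
    -- With `b = l⁻¹` the source term `c b h` is the required `(φ(l) / l)(x - K)⁺`.
    have hw := isWeakSolution_integral (b := l⁻¹) (charFun_bsExpLaw σ (hφ l hl))
      (integrable_exp_bsExpLaw σ (hφ l hl)) (continuous_callPayoff K) (fun x hx => by
        rw [abs_of_nonneg (callPayoff_nonneg _ _)]
        exact callPayoff_le hK hx.le) hloc
    refine ⟨hc.locallyIntegrableOn measurableSet_Ioi, fun η h1 h2 h3 => ?_⟩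
    refine Eq.trans (setIntegral_congr_fun measurableSet_Ioi fun x hx => ?_)
      (hw.weak_eq η h1 h2 h3)
    simp only [heq hx, div_eq_mul_inv]

end CallValue

/-! ### Uniqueness -/

lemma IsLaplaceSolution.exists_forall_ae_timeLaplace_eq {κ : ℝ} {ν : Measure ℝ} {σ : ℝ}
    (hσ : 0 < σ) (hφ : ∀ l, 0 < l → 0 < laplaceExponent κ ν l) {ψ : ℝ → ℝ} (hψ : Continuous ψ)
    {u v : ℝ → ℝ → ℝ}
    (hu : IsLaplaceSolution κ ν σ ψ u) (hv : IsLaplaceSolution κ ν σ ψ v) :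
    ∃ l₀ : ℝ, ∀ l, l₀ < l →
      (∀ x, 0 < x → IntegrableOn (fun t => Real.exp (-l * t) * u t x) (Ioi 0)) ∧
      (∀ x, 0 < x → IntegrableOn (fun t => Real.exp (-l * t) * v t x) (Ioi 0)) ∧
      ∀ᵐ x ∂(volume.restrict (Ioi (0 : ℝ))), timeLaplace u l x = timeLaplace v l x := by
  obtain ⟨l₁, h₁, hu⟩ := hu
  obtain ⟨l₂, h₂, hv⟩ := hv
  refine ⟨max l₁ l₂, fun l hl => ?_⟩
  obtain ⟨i1, ⟨C₁, b1⟩, w1⟩ := hu l ((le_max_left _ _).trans_lt hl)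
  obtain ⟨i2, ⟨C₂, b2⟩, w2⟩ := hv l ((le_max_right _ _).trans_lt hl)
  have hl0 : 0 < l := h₁.trans_lt ((le_max_left _ _).trans_lt hl)
  refine ⟨i1, i2, w1.ae_eq hσ (hφ l hl0) ?_ w2 b1 b2⟩
  exact (continuous_const.mul hψ).continuousOn

end TimeFractionalBS

end

/-! ### Well-posedness and the stochastic representation -/

theorem theorem5p5 {Ω : Type*} [MeasurableSpace Ω] (P : Measure Ω) [IsProbabilityMeasure P]
    (κ : ℝ) (hκ : 0 ≤ κ) (ν : Measure ℝ) (hν : TimeFractionalBS.IsLevyMeasure ν)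
    (hstrict : 0 < κ ∨ ν (Ioi 0) = ∞)
    (S : ℝ≥0 → Ω → ℝ) (hS : TimeFractionalBS.IsSubordinator κ ν S P)
    (B : ℝ≥0 → Ω → ℝ) (hB : IsBrownianReal B P)
    (hSB : IndepFun (fun ω r => S r ω) (fun ω r => B r ω) P)
    (σ : ℝ) (hσ : 0 < σ) (K : ℝ) (hK : 0 < K) :
    -- the expectation defining `u` is finite
    (∀ t x : ℝ, 0 ≤ t → 0 < x →
      Integrable (fun ω => TimeFractionalBS.callPayoff K (TimeFractionalBS.geometricBM σ B x
        (TimeFractionalBS.inverseSubordinator S t ω) ω)) P) ∧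
    -- `u` is a solution, continuous up to time `0`, with the right initial value
    TimeFractionalBS.IsLaplaceSolution κ ν σ (TimeFractionalBS.callPayoff K)
      (TimeFractionalBS.callValue P S B σ K) ∧
    ContinuousOn (fun p : ℝ × ℝ => TimeFractionalBS.callValue P S B σ K p.1 p.2)
      (Ici 0 ×ˢ Ioi 0) ∧
    (∀ x : ℝ, 0 < x →
      TimeFractionalBS.callValue P S B σ K 0 x = TimeFractionalBS.callPayoff K x) ∧
    -- every solution coincides with `u`
    (∀ v : ℝ → ℝ → ℝ,
      TimeFractionalBS.IsLaplaceSolution κ ν σ (TimeFractionalBS.callPayoff K) v →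
      (∀ᵐ x ∂(volume.restrict (Ioi (0 : ℝ))), ∀ᵐ t ∂(volume.restrict (Ioi (0 : ℝ))),
        v t x = TimeFractionalBS.callValue P S B σ K t x) ∧
      ((∃ l₁ : ℝ, ∀ l, l₁ < l → ContinuousOn (TimeFractionalBS.timeLaplace v l) (Ioi 0)) →
        ∀ x : ℝ, 0 < x → ∀ᵐ t ∂(volume.restrict (Ioi (0 : ℝ))),
          v t x = TimeFractionalBS.callValue P S B σ K t x) ∧
      (ContinuousOn (fun p : ℝ × ℝ => v p.1 p.2) (Ioi 0 ×ˢ Ioi 0) →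
        ∀ t x : ℝ, 0 < t → 0 < x →
          v t x = TimeFractionalBS.callValue P S B σ K t x)) := by
  open TimeFractionalBS in
  have hφ : ∀ l, 0 < l → 0 < laplaceExponent κ ν l := fun l hl =>
    laplaceExponent_pos hκ hν hstrict hl
  have hg := hS.ae_isGoodPath hκ hν hstrict
  have hm := hS.measurable
  have hsol := TimeFractionalBS.isLaplaceSolution_callValue (σ := σ) hg hB hSB hK.le hS hφ
  have hcont := TimeFractionalBS.continuousOn_callValue (σ := σ) hm hg hB hSB hK.le
  refine ⟨fun t x _ hx =>
    (TimeFractionalBS.integrable_callPayoff_and_callValue_eq hm hg hB hSB hK.le t hx.le).1,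
    hsol, hcont, fun x hx => TimeFractionalBS.callValue_zero hm hg hB hSB hK.le hx.le,
    fun v hv => ?_⟩
  obtain ⟨l₀, hl₀⟩ := hv.exists_forall_ae_timeLaplace_eq hσ hφ
    (TimeFractionalBS.continuous_callPayoff K) hsol
  have hae : ∀ᵐ x ∂(volume.restrict (Ioi (0 : ℝ))), ∀ᵐ t ∂(volume.restrict (Ioi (0 : ℝ))),
      v t x = TimeFractionalBS.callValue P S B σ K t x := by
    have h1 : ∀ᵐ x ∂(volume.restrict (Ioi (0 : ℝ))), ∀ n : ℕ, l₀ < n →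
        TimeFractionalBS.timeLaplace v n x =
          TimeFractionalBS.timeLaplace (TimeFractionalBS.callValue P S B σ K) n x := by
      rw [ae_all_iff]
      intro n
      by_cases hn : l₀ < n
      · filter_upwards [(hl₀ n hn).2.2] with x hx _ using hx
      · exact ae_of_all _ fun x h => absurd h hn
    filter_upwards [h1, ae_restrict_mem measurableSet_Ioi] with x hx hx0
    exact TimeFractionalBS.ae_eq_of_timeLaplace_eq (fun l hl => (hl₀ l hl).1 x hx0)
      (fun l hl => (hl₀ l hl).2.1 x hx0) hx
  refine ⟨hae, ?_, ?_⟩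
  · rintro ⟨l₁, hl₁⟩ x hx
    -- The `0` in the threshold guarantees `φ(n) > 0`, hence continuity of the transform of `u`; two
    -- continuous transforms equal almost everywhere on an open set are equal at every `x > 0`.
    refine TimeFractionalBS.ae_eq_of_timeLaplace_eq (l₀ := max 0 (max l₀ l₁))
      (fun l hl => (hl₀ l ?_).1 x hx) (fun l hl => (hl₀ l ?_).2.1 x hx) (fun n hn => ?_)
    · exact (max_lt_iff.1 (max_lt_iff.1 hl).2).1
    · exact (max_lt_iff.1 (max_lt_iff.1 hl).2).1
    · obtain ⟨h0, h2⟩ := max_lt_iff.1 hn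
      obtain ⟨h3, h4⟩ := max_lt_iff.1 h2
      exact Measure.eqOn_open_of_ae_eq (hl₀ n h3).2.2 isOpen_Ioi (hl₁ n h4)
        (TimeFractionalBS.continuousOn_timeLaplace_callValue hg hB hSB hK.le hS h0 (hφ n h0)) hx
  · intro hvc t x ht hx
    -- Continuity is used twice: in time, for almost every `x`, to reach the given `t`; then in
    -- space, at that `t`, to reach every `x`.
    have hslice : ∀ᵐ x ∂(volume.restrict (Ioi (0 : ℝ))),
        v t x = TimeFractionalBS.callValue P S B σ K t x := by
      filter_upwards [hae, ae_restrict_mem measurableSet_Ioi] with y hy hy0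
      refine Measure.eqOn_open_of_ae_eq (f := fun t => v t y)
        (g := fun t => TimeFractionalBS.callValue P S B σ K t y) hy isOpen_Ioi ?_ ?_ ht
      · exact hvc.comp (f := fun t => (t, y)) (by fun_prop) fun t ht => ⟨ht, hy0⟩
      · exact hcont.comp (f := fun t => (t, y)) (by fun_prop) fun t ht => ⟨le_of_lt (mem_Ioi.1 ht), hy0⟩
    refine Measure.eqOn_open_of_ae_eq (f := fun x => v t x)
      (g := fun x => TimeFractionalBS.callValue P S B σ K t x) hslice isOpen_Ioi ?_ ?_ hx
    · exact hvc.comp (f := fun x => (t, x)) (by fun_prop) fun x hx => ⟨ht, hx⟩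
    · exact hcont.comp (f := fun x => (t, x)) (by fun_prop) fun x hx => ⟨ht.le, hx⟩
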